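/- All graphs are finite and simple, and "subgraph" means not necessarily induced subgraph. The spectral radius $\lambda_1(G)$ of a graph $G$ is the largest eigenvalue of its adjacency matrix. For $\lambda\in\mathbb{R}$ let $\mathcal{F}(\lambda)$ be the family of connected (nonempty) graphs $G$ with $\lambda_1(G)\le\lambda$. For $m=1,2,\dots$ let $\beta_m$ be the largest real root of $x^{m+1}=1+x+\dots+x^{m-1}$, let $\alpha_m:=\beta_m^{1/2}+\beta_m^{-1/2}$, and let $\lambda^*:=\sqrt{2+\sqrt5}$. (1) For every real $\lambda<\lambda^*$ with $\lambda\notin\{\alpha_2,\alpha_3,\dots\}$ there is a finite set $\mathcal{G}$ of connected graphs such that $\mathcal{F}(\lambda)$ consists exactly of the connected graphs that do not contain any member of $\mathcal{G}$ as a subgraph. (2) For every $\lambda\in\{\alpha_2,\alpha_3,\dots\}\cup[\lambda^*,\infty)$ there is no finite set $\mathcal{G}$ of graphs, each of spectral radius greater than $\lambda$, such that $\mathcal{F}(\lambda)$ consists exactly of the connected graphs that do not contain any member of $\mathcal{G}$ as a subgraph (in particular there is no such finite set of connected graphs, since a connected member of such a $\mathcal{G}$ lies outside $\mathcal{F}(\lambda)$).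 Moreover, every such $\lambda$ is a right-sided limit point of the set of spectral radii of connected graphs: for every $\varepsilon>0$ some connected graph $G$ satisfies $\lambda<\lambda_1(G)<\lambda+\varepsilon$. -/

import Mathlib

noncomputable section

namespace ForbiddenSubgraphs

/-- A finite simple graph; every finite graph is isomorphic to one with vertex set `Fin n`. -/
structure FinGraph where
  order : ℕ
  graph : SimpleGraph (Fin order)

open Classical in
/-- The spectral radius `λ₁(G)`: the largest (real) eigenvalue of the adjacency matrix of `G`.
For a nonempty vertex set the supremum is attained, see `isGreatest_spectralRadius`. -/
def spectralRadius {V : Type*} [Fintype V] (G : SimpleGraph V) : ℝ :=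
  sSup {μ : ℝ | Module.End.HasEigenvalue (Matrix.toLin' (G.adjMatrix ℝ)) μ}

open Classical in
theorem isGreatest_spectralRadius {V : Type*} [Fintype V] [Nonempty V] (G : SimpleGraph V) :
    IsGreatest {μ : ℝ | Module.End.HasEigenvalue (Matrix.toLin' (G.adjMatrix ℝ)) μ}
      (spectralRadius G) := by
  have hA : (G.adjMatrix ℝ).IsHermitian := by
    rw [Matrix.IsHermitian, Matrix.conjTranspose_eq_transpose_of_trivial]
    exact SimpleGraph.isSymm_adjMatrix ..
  have hS : {μ : ℝ | Module.End.HasEigenvalue (Matrix.toLin' (G.adjMatrix ℝ)) μ}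
      = Set.range hA.eigenvalues := by
    rw [← hA.spectrum_real_eq_range_eigenvalues, ← Matrix.spectrum_toLin']
    ext μ
    exact Module.End.hasEigenvalue_iff_mem_spectrum
  have hfin : {μ : ℝ | Module.End.HasEigenvalue (Matrix.toLin' (G.adjMatrix ℝ)) μ}.Finite := by
    rw [hS]; exact Set.finite_range _
  have hne : {μ : ℝ | Module.End.HasEigenvalue (Matrix.toLin' (G.adjMatrix ℝ)) μ}.Nonempty := by
    rw [hS]; exact Set.range_nonempty _
  exact ⟨hne.csSup_mem hfin, fun _ h => le_csSup hfin.bddAbove h⟩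

/-- `𝓕(lam)`: the family of connected graphs of spectral radius at most `lam`. -/
def family (lam : ℝ) : Set FinGraph :=
  {H | H.graph.Connected ∧ spectralRadius H.graph ≤ lam}

/-- The connected graphs that contain no member of `𝒢` as a (not necessarily induced) subgraph. -/
def connectedAvoiding (𝒢 : Set FinGraph) : Set FinGraph :=
  {H | H.graph.Connected ∧ ∀ G ∈ 𝒢, ¬ G.graph.IsContained H.graph}

/-- `Λ₁`: the set of spectral radii of all connected graphs. -/
def spectralRadii : Set ℝ :=
  {x | ∃ H : FinGraph, H.graph.Connected ∧ spectralRadius H.graph = x}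

/-- The set of right-sided limit points of a set of reals. -/
def rightLimitPoints (S : Set ℝ) : Set ℝ :=
  {x | ∀ ε > 0, (Set.Ioo x (x + ε) ∩ S).Nonempty}

/-- `β m`: the largest real root of `x ^ (m + 1) = 1 + x + ⋯ + x ^ (m - 1)`, for `m ≥ 1`;
see `isGreatest_beta`. -/
def beta (m : ℕ) : ℝ :=
  sSup {x : ℝ | x ^ (m + 1) = ∑ i ∈ Finset.range m, x ^ i}

theorem isGreatest_beta (m : ℕ) (hm : 1 ≤ m) :
    IsGreatest {x : ℝ | x ^ (m + 1) = ∑ i ∈ Finset.range m, x ^ i} (beta m) := by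
  set S : Set ℝ := {x : ℝ | x ^ (m + 1) = ∑ i ∈ Finset.range m, x ^ i} with hS
  have key : ∀ x : ℝ, 1 ≤ x → ∑ i ∈ Finset.range m, x ^ i ≤ m * x ^ m := by
    intro x hx
    calc ∑ i ∈ Finset.range m, x ^ i ≤ ∑ _i ∈ Finset.range m, x ^ m :=
          Finset.sum_le_sum fun i hi =>
            pow_le_pow_right₀ hx (Finset.mem_range.1 hi).le
      _ = m * x ^ m := by simp
  have hm' : (1 : ℝ) ≤ m := by exact_mod_cast hm
  have hbdd : BddAbove S := by
    refine ⟨m, fun x hx => ?_⟩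
    by_contra hlt
    push Not at hlt
    have hx1 : 1 ≤ x := hm'.trans hlt.le
    have h1 := key x hx1
    have h2 : 0 < x ^ m := by positivity
    have hx' : x ^ (m + 1) = ∑ i ∈ Finset.range m, x ^ i := hx
    rw [pow_succ] at hx'
    nlinarith
  have hclosed : IsClosed S := isClosed_eq (by fun_prop) (by fun_prop)
  have hne : S.Nonempty := by
    have hc : ContinuousOn (fun x : ℝ => x ^ (m + 1) - ∑ i ∈ Finset.range m, x ^ i)
        (Set.Icc 1 m) := by fun_prop
    have h0 : (0 : ℝ) ∈ Set.Icc ((1 : ℝ) ^ (m + 1) - ∑ i ∈ Finset.range m, (1 : ℝ) ^ i)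
        ((m : ℝ) ^ (m + 1) - ∑ i ∈ Finset.range m, (m : ℝ) ^ i) := by
      refine ⟨by simp [hm'], ?_⟩
      have := key m hm'
      rw [pow_succ]
      nlinarith
    obtain ⟨x, -, hx⟩ := intermediate_value_Icc hm' hc h0
    exact ⟨x, sub_eq_zero.1 hx⟩
  exact ⟨hclosed.csSup_mem hne hbdd, fun _ h => le_csSup hbdd h⟩

/-- `α m = (β m)^{1/2} + (β m)^{-1/2}`. -/
def alpha (m : ℕ) : ℝ :=
  beta m ^ (1 / 2 : ℝ) + beta m ^ (-(1 / 2) : ℝ)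

/-- `λ* = √(2 + √5)`. -/
def lambdaStar : ℝ :=
  Real.sqrt (2 + Real.sqrt 5)

end ForbiddenSubgraphs

end

/-! A positive vector `x` with `A x ≤ lam x` bounds the spectral radius by `lam`
(`spectralRadius_le`), and Rayleigh quotients bound it from below. For `lam ≥ 2` write `lam = t +
1/t` with `t ≥ 1`. Along a path the eigenvalue equation acts on ratios of consecutive values by `c ↦
lam - 1/c`, with fixed points `t` and `1/t`; a pendant path on `k` vertices costs its attachment
vertex `pathRatio lam k`, which increases to `1/t`.

Negative half: by monotonicity, finitely many forbidden graphs leave a gap above `lam`, which is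
impossible at a right limit point (`not_exists_finite_of_mem_rightLimitPoints`). At `alpha m` the
spider with legs `1`, `m`, `∞` is exactly critical, so long versions of it with two leaves at the
far end have radii just above `alpha m` (`alpha_mem_rightLimitPoints`). Every number above `λ*` is
approximated from below by caterpillars with greedily attached leaves, as in Shearer's theorem; an
energy that never increases along the spine controls the error (`exists_spectralRadius_mem_Icc`).

Positive half: it suffices to find `B` such that a bound on all connected induced subgraphs with at
most `B` vertices implies the bound for the whole graph (`exists_finite_forbidden`). Degrees are at
most `4`, so a bounded longest path means a bounded graph. For `lam < 2` paths are bounded. For `2 ≤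
lam < λ*` small trees force a graph with a long longest path to be a cycle or a path with at most
one extra leaf near each end (`Thresholds.end_structure`, `Thresholds.supersolution_of_chord`). Each
branch vertex, with the long side replaced by an infinite leg, has nonnegative slack. For `t > 1`
the slack vanishes only if `lam` is some `alpha m`; otherwise it absorbs the exponentially small
interaction of the two ends. The value `lam = 2` has an explicit vector. -/

noncomputable section

namespace ForbiddenSubgraphs

open Finset

/-! ### Perron–Frobenius facts and Rayleigh quotients. -/

section Spectral
variable {V : Type*} [Fintype V]

open Classical in
/-- The sum of `x` over the neighbours of `v`. -/
def nbSum (G : SimpleGraph V) (x : V → ℝ) (v : V) : ℝ := ∑ u with G.Adj v u, x u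

open Classical in
theorem adjMatrix_mulVec_eq_nbSum (G : SimpleGraph V) (x : V → ℝ) :
    (G.adjMatrix ℝ).mulVec x = nbSum G x := by
  ext v
  simp [Matrix.mulVec, dotProduct, SimpleGraph.adjMatrix_apply, nbSum, Finset.sum_filter]

theorem sum_mul_nbSum_comm (G : SimpleGraph V) (x y : V → ℝ) :
    ∑ v, x v * nbSum G y v = ∑ v, y v * nbSum G x v := by
  classical
  simp only [nbSum, Finset.sum_filter, Finset.mul_sum]
  rw [Finset.sum_comm]
  refine Finset.sum_congr rfl fun u _ => Finset.sum_congr rfl fun v _ => ?_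
  simp only [G.adj_comm u v, mul_ite, mul_zero]
  split_ifs <;> ring

-- In this form both the Rayleigh bound and its equality case, through the kernel, are available.
open Classical in
theorem posSemidef_spectralRadius_sub [Nonempty V] (G : SimpleGraph V) :
    (spectralRadius G • (1 : Matrix V V ℝ) - G.adjMatrix ℝ).PosSemidef := by
  have hA : (G.adjMatrix ℝ).IsHermitian := by
    rw [Matrix.IsHermitian, Matrix.conjTranspose_eq_transpose_of_trivial]
    exact SimpleGraph.isSymm_adjMatrix ..
  have hM : (spectralRadius G • (1 : Matrix V V ℝ) - G.adjMatrix ℝ).IsHermitian := by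
    refine Matrix.IsHermitian.sub ?_ hA
    simp [Matrix.IsHermitian]
  rw [hM.posSemidef_iff_eigenvalues_nonneg]
  intro i
  have h1 := hM.mulVec_eigenvectorBasis i
  have h0 : (hM.eigenvectorBasis i).ofLp ≠ 0 := by
    intro h
    have := hM.eigenvectorBasis.orthonormal.ne_zero i
    exact this (by ext j; simpa using congrFun h j)
  set z := (hM.eigenvectorBasis i).ofLp with hz
  rw [Matrix.sub_mulVec, Matrix.smul_mulVec, Matrix.one_mulVec] at h1
  -- An eigenvalue `μ` of `λ₁ - A` gives the eigenvalue `λ₁ - μ` of `A`, which is at most `λ₁`.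
  have h2 : (G.adjMatrix ℝ).mulVec z = (spectralRadius G - hM.eigenvalues i) • z := by
    rw [sub_smul, ← h1]; abel
  have h3 : Module.End.HasEigenvalue (Matrix.toLin' (G.adjMatrix ℝ))
      (spectralRadius G - hM.eigenvalues i) :=
    Module.End.hasEigenvalue_of_hasEigenvector
      (x := z) ⟨by rw [Module.End.mem_eigenspace_iff, Matrix.toLin'_apply, h2], h0⟩
  have := (isGreatest_spectralRadius G).2 h3
  simp only [Pi.zero_apply]
  linarith

theorem sum_mul_nbSum_le [Nonempty V] (G : SimpleGraph V) (x : V → ℝ) :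
    ∑ v, x v * nbSum G x v ≤ spectralRadius G * ∑ v, x v ^ 2 := by
  classical
  have h := (posSemidef_spectralRadius_sub G).dotProduct_mulVec_nonneg x
  rw [Matrix.sub_mulVec, Matrix.smul_mulVec, Matrix.one_mulVec, dotProduct_sub] at h
  rw [adjMatrix_mulVec_eq_nbSum] at h
  simp only [dotProduct, Pi.star_apply, star_trivial, Pi.smul_apply, smul_eq_mul] at h
  rw [Finset.mul_sum]
  have : ∑ i, x i * (spectralRadius G * x i) = ∑ i, spectralRadius G * x i ^ 2 :=
    Finset.sum_congr rfl fun i _ => by ring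
  linarith

/-- A positive semidefinite form vanishes only on its kernel, so equality in the Rayleigh bound
forces an eigenvector. -/
theorem nbSum_eq_of_sum_eq [Nonempty V] (G : SimpleGraph V) {x : V → ℝ}
    (h : spectralRadius G * ∑ v, x v ^ 2 ≤ ∑ v, x v * nbSum G x v) (v : V) :
    nbSum G x v = spectralRadius G * x v := by
  classical
  have h' := le_antisymm h (sum_mul_nbSum_le G x)
  have h0 := ((posSemidef_spectralRadius_sub G).dotProduct_mulVec_zero_iff x).1 (by
    rw [Matrix.sub_mulVec, Matrix.smul_mulVec, Matrix.one_mulVec, dotProduct_sub,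
      adjMatrix_mulVec_eq_nbSum]
    simp only [dotProduct, Pi.star_apply, star_trivial, Pi.smul_apply, smul_eq_mul]
    rw [← h', Finset.mul_sum, sub_eq_zero]
    exact Finset.sum_congr rfl fun i _ => by ring)
  rw [Matrix.sub_mulVec, Matrix.smul_mulVec, Matrix.one_mulVec, adjMatrix_mulVec_eq_nbSum] at h0
  have := congrFun h0 v
  simp at this
  linarith

/-- Taking entrywise absolute values of an eigenvector for `λ₁` does not lower its Rayleigh
quotient, so the equality case applies. -/
theorem exists_eigenvector_nonneg [Nonempty V] (G : SimpleGraph V) :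
    ∃ x : V → ℝ, (∀ v, 0 ≤ x v) ∧ (∃ v, 0 < x v) ∧
      ∀ v, nbSum G x v = spectralRadius G * x v := by
  classical
  obtain ⟨z, hz⟩ := (isGreatest_spectralRadius G).1.exists_hasEigenvector
  have hz1 : ∀ v, nbSum G z v = spectralRadius G * z v := by
    intro v
    have := hz.apply_eq_smul
    rw [Matrix.toLin'_apply, adjMatrix_mulVec_eq_nbSum] at this
    simpa using congrFun this v
  obtain ⟨v, hv⟩ := Function.ne_iff.1 hz.2
  refine ⟨fun v => |z v|, fun v => abs_nonneg _, ⟨v, abs_pos.2 hv⟩, ?_⟩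
  refine nbSum_eq_of_sum_eq G ?_
  rw [Finset.mul_sum]
  refine Finset.sum_le_sum fun v _ => ?_
  have h1 : |nbSum G z v| ≤ nbSum G (fun v => |z v|) v := Finset.abs_sum_le_sum_abs _ _
  have h2 : spectralRadius G * |z v| ^ 2 = z v * nbSum G z v := by rw [hz1, sq_abs]; ring
  rw [h2]
  calc z v * nbSum G z v ≤ |z v| * |nbSum G z v| := by rw [← abs_mul]; exact le_abs_self _
    _ ≤ _ := mul_le_mul_of_nonneg_left h1 (abs_nonneg _)

theorem le_nbSum_of_adj (G : SimpleGraph V) {x : V → ℝ} (hx : ∀ v, 0 ≤ x v) {u v : V}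
    (h : G.Adj v u) : x u ≤ nbSum G x v := by
  classical
  exact Finset.single_le_sum (f := x) (fun i _ => hx i) (by simp [h])

/-- The Perron vector of a connected graph. -/
theorem exists_eigenvector_pos [Nonempty V] {G : SimpleGraph V} (hG : G.Connected) :
    ∃ x : V → ℝ, (∀ v, 0 < x v) ∧ ∀ v, nbSum G x v = spectralRadius G * x v := by
  obtain ⟨x, h0, ⟨v, hv⟩, hx⟩ := exists_eigenvector_nonneg G
  refine ⟨x, fun w => ?_, hx⟩
  obtain ⟨p⟩ := hG.preconnected v w
  clear hG
  induction p with
  | nil => exact hv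
  | @cons a b c hab p ih =>
    -- If the vector vanished at `b`, the equation at `b` would force it to vanish at the neighbour
    -- `a`.
    refine ih ((h0 b).lt_of_ne fun hb => ?_)
    have h1 := le_nbSum_of_adj G h0 hab.symm
    rw [hx, ← hb, mul_zero] at h1
    linarith

/-- A positive supersolution bounds the spectral radius from above. -/
theorem spectralRadius_le [Nonempty V] (G : SimpleGraph V) {x : V → ℝ} {μ : ℝ}
    (hx : ∀ v, 0 < x v) (h : ∀ v, nbSum G x v ≤ μ * x v) : spectralRadius G ≤ μ := by
  obtain ⟨y, h0, ⟨w, hw⟩, hy⟩ := exists_eigenvector_nonneg G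
  -- Pair the supersolution with a nonnegative eigenvector and move `A` across by symmetry.
  have h1 : spectralRadius G * ∑ v, x v * y v ≤ μ * ∑ v, x v * y v := by
    calc spectralRadius G * ∑ v, x v * y v = ∑ v, x v * nbSum G y v := by
          rw [Finset.mul_sum]
          exact Finset.sum_congr rfl fun v _ => by rw [hy]; ring
      _ = ∑ v, y v * nbSum G x v := sum_mul_nbSum_comm G x y
      _ ≤ ∑ v, y v * (μ * x v) :=
          Finset.sum_le_sum fun v _ => mul_le_mul_of_nonneg_left (h v) (h0 v)
      _ = _ := by
          rw [Finset.mul_sum]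
          exact Finset.sum_congr rfl fun v _ => by ring
  refine le_of_mul_le_mul_right h1 (Finset.sum_pos' (fun v _ => mul_nonneg (hx v).le (h0 v))
    ⟨w, Finset.mem_univ w, mul_pos (hx w) hw⟩)

theorem le_spectralRadius [Nonempty V] (G : SimpleGraph V) {x : V → ℝ} {μ : ℝ}
    (hx : 0 < ∑ v, x v ^ 2) (h : μ * ∑ v, x v ^ 2 ≤ ∑ v, x v * nbSum G x v) :
    μ ≤ spectralRadius G :=
  le_of_mul_le_mul_right (h.trans (sum_mul_nbSum_le G x)) hx

theorem lt_spectralRadius [Nonempty V] (G : SimpleGraph V) {x : V → ℝ} {μ : ℝ}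
    (hx : 0 < ∑ v, x v ^ 2) (h : μ * ∑ v, x v ^ 2 < ∑ v, x v * nbSum G x v) :
    μ < spectralRadius G :=
  lt_of_mul_lt_mul_right (h.trans_le (sum_mul_nbSum_le G x)) hx.le

/-- A nonnegative eigenvector of the smaller graph, extended by zero, is a test vector for the
larger one. -/
theorem spectralRadius_mono {W : Type*} [Fintype W] [Nonempty W] {G : SimpleGraph W}
    {H : SimpleGraph V} (h : G.IsContained H) : spectralRadius G ≤ spectralRadius H := by
  classical
  obtain ⟨f⟩ := h
  obtain ⟨y, h0, ⟨w, hw⟩, hy⟩ := exists_eigenvector_nonneg G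
  have : Nonempty V := ⟨f w⟩
  have hf : Function.Injective f := f.injective
  set x : V → ℝ := Function.extend f y 0 with hx
  have hxf : ∀ w, x (f w) = y w := fun w => hf.extend_apply y 0 w
  have hx0 : ∀ v, v ∉ Finset.univ.image f → x v = 0 := by
    intro v hv
    rw [hx, Function.extend_apply']
    · rfl
    · rintro ⟨a, rfl⟩; simp at hv
  have hxn : ∀ v, 0 ≤ x v := by
    intro v
    by_cases hv : v ∈ Finset.univ.image f
    · obtain ⟨a, -, rfl⟩ := Finset.mem_image.1 hv
      rw [hxf]; exact h0 a
    · rw [hx0 v hv]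
  have hs : ∀ F : V → ℝ, (∀ v, x v = 0 → F v = 0) → ∑ v, F v = ∑ w, F (f w) := by
    intro F hF
    rw [← Finset.sum_image (s := Finset.univ) (g := f) (f := F) (fun a _ b _ h => hf h)]
    exact (Finset.sum_subset (Finset.subset_univ _) fun v _ hv => hF v (hx0 v hv)).symm
  refine le_spectralRadius H (x := x) ?_ ?_
  · exact Finset.sum_pos' (fun v _ => sq_nonneg _)
      ⟨f w, Finset.mem_univ _, by rw [hxf]; positivity⟩
  · rw [hs _ (fun v hv => by simp [hv]), hs _ (fun v hv => by simp [hv]), Finset.mul_sum]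
    refine Finset.sum_le_sum fun a _ => ?_
    rw [hxf]
    have h1 : nbSum G y a ≤ nbSum H x (f a) := by
      unfold nbSum
      calc ∑ u with G.Adj a u, y u = ∑ u with G.Adj a u, x (f u) :=
            Finset.sum_congr rfl fun u _ => (hxf u).symm
        _ = ∑ v ∈ ({u | G.Adj a u} : Finset W).image f, x v :=
            (Finset.sum_image fun a _ b _ h => hf h).symm
        _ ≤ _ := by
            refine Finset.sum_le_sum_of_subset_of_nonneg ?_ fun v _ _ => hxn v
            intro v hv
            obtain ⟨u, hu, rfl⟩ := Finset.mem_image.1 hv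
            simp only [Finset.mem_filter, Finset.mem_univ, true_and] at hu ⊢
            exact f.toHom.map_adj hu
    rw [hy] at h1
    calc spectralRadius G * y a ^ 2 = y a * (spectralRadius G * y a) := by ring
      _ ≤ _ := mul_le_mul_of_nonneg_left h1 (h0 a)

theorem spectralRadius_congr {W : Type*} [Fintype W] [Nonempty W] [Nonempty V]
    {G : SimpleGraph W} {H : SimpleGraph V} (e : G ≃g H) :
    spectralRadius G = spectralRadius H :=
  le_antisymm (spectralRadius_mono ⟨e.toCopy⟩) (spectralRadius_mono ⟨e.symm.toCopy⟩)

end Spectral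

/-- Every finite graph has an isomorphic copy on `Fin n`. -/
theorem exists_finGraph_iso {V : Type*} [Fintype V] (G : SimpleGraph V) :
    ∃ H : FinGraph, H.order = Fintype.card V ∧ Nonempty (G ≃g H.graph) := by
  let e := Fintype.equivFin V
  exact ⟨⟨Fintype.card V, G.map e.toEmbedding⟩, rfl, ⟨SimpleGraph.Iso.map e G⟩⟩

/-! ### Rooted graphs and the calculus of root defects. -/

/-- A finite connected graph with a distinguished vertex. -/
structure RootedGraph where
  V : Type
  [fintype : Fintype V]
  graph : SimpleGraph V
  root : V
  connected : graph.Connected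

attribute [instance] RootedGraph.fintype

namespace RootedGraph

instance (A : RootedGraph) : Nonempty A.V := ⟨A.root⟩

/-- The one-vertex rooted graph. -/
def point : RootedGraph where
  V := Unit
  graph := ⊥
  root := ()
  connected := SimpleGraph.Connected.mk fun _ _ => SimpleGraph.Reachable.refl _

/-- The disjoint union of two graphs with an edge added between the roots. -/
def joinGraph {V W : Type*} (G : SimpleGraph V) (H : SimpleGraph W) (r : V) (s : W) :
    SimpleGraph (V ⊕ W) where
  Adj
    | .inl a, .inl b => G.Adj a b
    | .inr a, .inr b => H.Adj a b
    | .inl a, .inr b => a = r ∧ b = s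
    | .inr a, .inl b => b = r ∧ a = s
  symm := ⟨by
    rintro (a | a) (b | b) h
    · exact G.adj_symm h
    · exact h
    · exact h
    · exact H.adj_symm h⟩
  loopless := ⟨by
    rintro (a | a) h
    · exact G.loopless.irrefl a h
    · exact H.loopless.irrefl a h⟩

/-- The rooted graph obtained by joining the roots; the root is that of the first graph. -/
def join (A B : RootedGraph) : RootedGraph where
  V := A.V ⊕ B.V
  graph := joinGraph A.graph B.graph A.root B.root
  root := .inl A.root
  connected := by
    let fA : A.graph →g joinGraph A.graph B.graph A.root B.root := ⟨Sum.inl, fun h => h⟩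
    let fB : B.graph →g joinGraph A.graph B.graph A.root B.root := ⟨Sum.inr, fun h => h⟩
    have hA : ∀ a, (joinGraph A.graph B.graph A.root B.root).Reachable (.inl A.root) (.inl a) :=
      fun a => (A.connected.preconnected A.root a).map fA
    have hB : ∀ b, (joinGraph A.graph B.graph A.root B.root).Reachable (.inl A.root) (.inr b) := by
      intro b
      have h1 : (joinGraph A.graph B.graph A.root B.root).Adj (.inl A.root) (.inr B.root) :=
        ⟨rfl, rfl⟩
      exact h1.reachable.trans ((B.connected.preconnected B.root b).map fB)
    rw [SimpleGraph.connected_iff_exists_forall_reachable]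
    refine ⟨.inl A.root, ?_⟩
    rintro (a | b)
    · exact hA a
    · exact hB b

/-- `A.Eval lam c q`: there is a positive vector that has value `1` at the root, satisfies the
eigenvalue equation for `lam` away from the root with defect `c` at the root, and has squared
norm at least `q`. -/
def Eval (A : RootedGraph) (lam c q : ℝ) : Prop :=
  ∃ x : A.V → ℝ, (∀ v, 0 < x v) ∧ x A.root = 1 ∧
    (∀ v, v ≠ A.root → nbSum A.graph x v = lam * x v) ∧
    nbSum A.graph x A.root = lam - c ∧ q ≤ ∑ v, x v ^ 2

theorem eval_point (lam : ℝ) : point.Eval lam lam 1 := by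
  classical
  refine ⟨fun _ => 1, fun _ => one_pos, rfl, fun v hv => absurd rfl hv, ?_, ?_⟩
  · simp [nbSum, point]
  · have : Fintype.card point.V = 1 := rfl
    simp [this]

theorem nbSum_join_inl {V W : Type*} [Fintype V] [Fintype W] (G : SimpleGraph V)
    (H : SimpleGraph W) (r : V) (s : W) (x : V ⊕ W → ℝ) (v : V) [Decidable (v = r)] :
    nbSum (joinGraph G H r s) x (.inl v) =
      nbSum G (fun a => x (.inl a)) v + if v = r then x (.inr s) else 0 := by
  classical
  simp only [nbSum, Finset.sum_filter, Fintype.sum_sum_type]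
  congr 1
  split_ifs with h
  · simp [joinGraph, h]
  · simp [joinGraph, h]

theorem nbSum_join_inr {V W : Type*} [Fintype V] [Fintype W] (G : SimpleGraph V)
    (H : SimpleGraph W) (r : V) (s : W) (x : V ⊕ W → ℝ) (w : W) [Decidable (w = s)] :
    nbSum (joinGraph G H r s) x (.inr w) =
      nbSum H (fun a => x (.inr a)) w + if w = s then x (.inl r) else 0 := by
  classical
  simp only [nbSum, Finset.sum_filter, Fintype.sum_sum_type]
  rw [add_comm]
  congr 1
  split_ifs with h
  · simp [joinGraph, h]
  · simp [joinGraph, h]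

theorem nbSum_const_mul {V : Type*} [Fintype V] (G : SimpleGraph V) (x : V → ℝ) (a : ℝ) (v : V) :
    nbSum G (fun u => a * x u) v = a * nbSum G x v := by
  simp [nbSum, Finset.mul_sum]

/-- Scaling the vector of `B` by `1 / b` makes the new edge supply exactly the defect at its root,
while the root of `A` gains `1 / b`. -/
theorem Eval.join {A B : RootedGraph} {lam a b p q : ℝ} (hA : A.Eval lam a p)
    (hB : B.Eval lam b q) (hb : 0 < b) : (A.join B).Eval lam (a - 1 / b) (p + q / b ^ 2) := by
  classical
  obtain ⟨x, x0, x1, xe, xr, xq⟩ := hA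
  obtain ⟨y, y0, y1, ye, yr, yq⟩ := hB
  refine ⟨Sum.elim x (fun w => 1 / b * y w), ?_, x1, ?_, ?_, ?_⟩
  · rintro (v | w)
    · exact x0 v
    · exact mul_pos (by positivity) (y0 w)
  · rintro (v | w) hv
    · have hv' : v ≠ A.root := fun h => hv (by rw [h]; rfl)
      refine (nbSum_join_inl A.graph B.graph A.root B.root _ v).trans ?_
      rw [if_neg hv', add_zero]
      exact xe v hv'
    · refine (nbSum_join_inr A.graph B.graph A.root B.root _ w).trans ?_
      simp only [Sum.elim_inr, Sum.elim_inl, nbSum_const_mul]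
      split_ifs with h
      · subst h
        rw [yr, y1, x1]; field_simp; ring
      · rw [ye w h]; ring
  · refine (nbSum_join_inl A.graph B.graph A.root B.root _ A.root).trans ?_
    rw [if_pos rfl]
    simp only [Sum.elim_inr, Sum.elim_inl]
    rw [xr, y1]; ring
  · change _ ≤ ∑ v : A.V ⊕ B.V, _
    simp only [Fintype.sum_sum_type, Sum.elim_inr, Sum.elim_inl, mul_pow, ← Finset.mul_sum]
    have : q / b ^ 2 ≤ (1 / b) ^ 2 * ∑ w, y w ^ 2 := by
      rw [div_eq_mul_inv, mul_comm, one_div, inv_pow]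
      exact mul_le_mul_of_nonneg_left yq (by positivity)
    linarith

theorem sum_mul_nbSum_of_defect {A : RootedGraph} {lam c : ℝ} {x : A.V → ℝ} (x1 : x A.root = 1)
    (xe : ∀ v, v ≠ A.root → nbSum A.graph x v = lam * x v)
    (xr : nbSum A.graph x A.root = lam - c) :
    ∑ v, x v * nbSum A.graph x v = lam * ∑ v, x v ^ 2 - c := by
  classical
  have : ∀ v, x v * nbSum A.graph x v = lam * x v ^ 2 - if v = A.root then c else 0 := by
    intro v
    split_ifs with h
    · subst h; rw [xr, x1]; ring
    · rw [xe v h]; ring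
  simp only [this, Finset.sum_sub_distrib, ← Finset.mul_sum]
  simp

theorem Eval.spectralRadius_le {A : RootedGraph} {lam c q : ℝ} (h : A.Eval lam c q)
    (hc : 0 ≤ c) : spectralRadius A.graph ≤ lam := by
  obtain ⟨x, x0, x1, xe, xr, -⟩ := h
  refine ForbiddenSubgraphs.spectralRadius_le A.graph x0 fun v => ?_
  by_cases hv : v = A.root
  · subst hv; rw [xr, x1]; linarith
  · exact (xe v hv).le

theorem Eval.lt_spectralRadius {A : RootedGraph} {lam c q : ℝ} (h : A.Eval lam c q)
    (hc : c < 0) : lam < spectralRadius A.graph := by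
  obtain ⟨x, x0, x1, xe, xr, -⟩ := h
  refine ForbiddenSubgraphs.lt_spectralRadius A.graph (x := x) ?_ ?_
  · exact Finset.sum_pos (fun v _ => by have := x0 v; positivity) ⟨A.root, Finset.mem_univ _⟩
  · rw [sum_mul_nbSum_of_defect x1 xe xr]; linarith

/-- The certifying vector has Rayleigh quotient `lam - c / ‖x‖²`; this is why `Eval` records a lower
bound for the norm. -/
theorem Eval.sub_le_spectralRadius {A : RootedGraph} {lam c q δ : ℝ} (h : A.Eval lam c q)
    (hδ : 0 ≤ δ) (hc : c ≤ δ * q) : lam - δ ≤ spectralRadius A.graph := by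
  obtain ⟨x, x0, x1, xe, xr, xq⟩ := h
  refine le_spectralRadius A.graph (x := x) ?_ ?_
  · exact Finset.sum_pos (fun v _ => by have := x0 v; positivity) ⟨A.root, Finset.mem_univ _⟩
  · rw [sum_mul_nbSum_of_defect x1 xe xr]
    have := mul_le_mul_of_nonneg_left xq hδ
    linarith

theorem Eval.mono {A : RootedGraph} {lam c p q : ℝ} (h : A.Eval lam c q) (hpq : p ≤ q) :
    A.Eval lam c p := by
  obtain ⟨x, x0, x1, xe, xr, xq⟩ := h
  exact ⟨x, x0, x1, xe, xr, hpq.trans xq⟩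

theorem Eval.norm_zero {A : RootedGraph} {lam c q : ℝ} (h : A.Eval lam c q) :
    A.Eval lam c 0 := by
  obtain ⟨x, x0, x1, xe, xr, -⟩ := h
  exact ⟨x, x0, x1, xe, xr, Finset.sum_nonneg fun _ _ => sq_nonneg _⟩

/-- Add a new root joined to the old one. -/
def extend (A : RootedGraph) : RootedGraph := point.join A

/-- Add a leaf at the root. -/
def addLeaf (A : RootedGraph) : RootedGraph := A.join point

theorem Eval.extend {A : RootedGraph} {lam c q : ℝ} (h : A.Eval lam c q) (hc : 0 < c) :
    A.extend.Eval lam (lam - 1 / c) (1 + q / c ^ 2) :=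
  (eval_point lam).join h hc

theorem Eval.addLeaf {A : RootedGraph} {lam c q : ℝ} (h : A.Eval lam c q) (hlam : 0 < lam) :
    A.addLeaf.Eval lam (c - 1 / lam) q :=
  (h.join (eval_point lam) hlam).mono (by have : 0 < 1 / lam ^ 2 := by positivity
                                          linarith)

theorem Eval.addLeaf_iterate {A : RootedGraph} {lam c q : ℝ} (h : A.Eval lam c q)
    (hlam : 0 < lam) (d : ℕ) : (RootedGraph.addLeaf^[d] A).Eval lam (c - d / lam) q := by
  induction d with
  | zero => simpa using h
  | succ d ih =>
    rw [Function.iterate_succ_apply']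
    convert ih.addLeaf hlam using 1
    push_cast; ring

end RootedGraph

theorem spectralRadius_mem_spectralRadii (A : RootedGraph) :
    spectralRadius A.graph ∈ spectralRadii := by
  obtain ⟨H, -, ⟨e⟩⟩ := exists_finGraph_iso A.graph
  have hH : H.graph.Connected := e.connected_iff.1 A.connected
  have : Nonempty (Fin H.order) := ⟨e A.root⟩
  exact ⟨H, hH, (spectralRadius_congr e).symm⟩

/-- Finitely many radii above `lam` stay away from `lam`. A connected graph with radius in the gap
is outside the family but too small to contain a forbidden graph. -/
theorem not_exists_finite_of_mem_rightLimitPoints {lam : ℝ} (h0 : 0 ≤ lam)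
    (h : lam ∈ rightLimitPoints spectralRadii) :
    ¬ ∃ 𝒢 : Set FinGraph, 𝒢.Finite ∧ (∀ G ∈ 𝒢, lam < spectralRadius G.graph) ∧
        family lam = connectedAvoiding 𝒢 := by
  rintro ⟨𝒢, hfin, hlt, heq⟩
  obtain ⟨ε, hε, hmin⟩ : ∃ ε > 0, ∀ G ∈ 𝒢, lam + ε ≤ spectralRadius G.graph := by
    rcases 𝒢.eq_empty_or_nonempty with rfl | hne
    · exact ⟨1, one_pos, by simp⟩
    · obtain ⟨G₀, hG₀, hm⟩ := Set.exists_min_image 𝒢 (fun G => spectralRadius G.graph) hfin hne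
      exact ⟨spectralRadius G₀.graph - lam, sub_pos.2 (hlt _ hG₀), fun G hG => by
        have := hm G hG; linarith⟩
  obtain ⟨_, ⟨h1, h2⟩, H, hH, rfl⟩ := h ε hε
  have hnot : H ∉ connectedAvoiding 𝒢 := by
    rw [← heq]
    exact fun hm => absurd hm.2 (not_le.2 h1)
  simp only [connectedAvoiding, Set.mem_ofPred_eq, not_and, not_forall, not_not] at hnot
  obtain ⟨G, hG, hGH⟩ := hnot hH
  -- The graph without vertices has the default radius `sSup ∅ = 0`, excluded by `0 ≤ lam`.
  have hne : Nonempty (Fin G.order) := by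
    by_contra hemp
    rw [not_nonempty_iff] at hemp
    have h3 : spectralRadius G.graph = 0 := by
      unfold spectralRadius
      convert Real.sSup_empty
      refine Set.eq_empty_of_forall_notMem fun μ hμ => ?_
      obtain ⟨z, hz⟩ := Module.End.HasEigenvalue.exists_hasEigenvector hμ
      exact hz.2 (Subsingleton.elim _ _)
    linarith [hlt G hG]
  have := spectralRadius_mono hGH
  linarith [hmin G hG]

/-! ### The parametrization `lam = t + 1/t` and path ratios. -/

section Param

theorem exists_add_inv_eq {lam : ℝ} (h : 2 ≤ lam) : ∃ t : ℝ, 1 ≤ t ∧ lam = t + 1 / t := by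
  have h0 : 0 ≤ lam ^ 2 - 4 := by nlinarith
  have hs := Real.sq_sqrt h0
  have hs0 := Real.sqrt_nonneg (lam ^ 2 - 4)
  refine ⟨(lam + Real.sqrt (lam ^ 2 - 4)) / 2, by linarith, ?_⟩
  have : 0 < lam + Real.sqrt (lam ^ 2 - 4) := by linarith
  field_simp
  nlinarith

theorem add_inv_lt_add_inv {s t : ℝ} (hs : 1 ≤ s) (hst : s < t) : s + 1 / s < t + 1 / t := by
  have hs0 : 0 < s := by linarith
  have ht0 : 0 < t := by linarith
  have h1 : t + 1 / t - (s + 1 / s) = (t - s) * (s * t - 1) / (s * t) := by field_simp; ring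
  have h2 : 0 < (t - s) * (s * t - 1) / (s * t) :=
    div_pos (mul_pos (by linarith) (by nlinarith)) (by positivity)
  linarith

theorem lt_of_add_inv_lt {s t : ℝ} (ht : 1 ≤ t) (h : s + 1 / s < t + 1 / t) (hs : 1 ≤ s) :
    s < t := by
  by_contra! hts
  rcases hts.eq_or_lt with rfl | h'
  · exact lt_irrefl _ h
  · exact lt_asymm h (add_inv_lt_add_inv ht h')

theorem lambdaStar_sq : lambdaStar ^ 2 = 2 + Real.sqrt 5 :=
  Real.sq_sqrt (by positivity)

theorem lambdaStar_nonneg : 0 ≤ lambdaStar := Real.sqrt_nonneg _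

theorem two_le_lambdaStar : 2 ≤ lambdaStar := by
  refine Real.le_sqrt_of_sq_le ?_
  have : (2 : ℝ) ≤ Real.sqrt 5 := Real.le_sqrt_of_sq_le (by norm_num)
  linarith

theorem lambdaStar_sq_lt : lambdaStar ^ 2 < 4.24 := by
  have : Real.sqrt 5 < 2.24 := by
    rw [Real.sqrt_lt' (by norm_num)]; norm_num
  rw [lambdaStar_sq]; linarith

/-- With `x = t²` one has `lam² = x + 1/x + 2`, and `x² = x + 1` means `x - 1/x = 1`, that is `x +
1/x = √5`: the threshold `λ*` corresponds to `t²` being the golden ratio. -/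
theorem sq_lt_add_one_of_lt_lambdaStar {t : ℝ} (ht : 1 ≤ t) (h : t + 1 / t < lambdaStar) :
    (t ^ 2) ^ 2 < t ^ 2 + 1 := by
  have ht0 : 0 < t := by linarith
  have h1 : (t + 1 / t) ^ 2 < 2 + Real.sqrt 5 := by
    rw [← lambdaStar_sq]
    exact pow_lt_pow_left₀ h (by positivity) two_ne_zero
  have h2 : (t + 1 / t) ^ 2 = t ^ 2 + 1 / t ^ 2 + 2 := by field_simp; ring
  by_contra! hle
  have h3 : 1 ≤ t ^ 2 - 1 / t ^ 2 := by
    have : t ^ 2 - 1 / t ^ 2 - 1 = ((t ^ 2) ^ 2 - (t ^ 2 + 1)) / t ^ 2 := by field_simp; ring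
    have : 0 ≤ ((t ^ 2) ^ 2 - (t ^ 2 + 1)) / t ^ 2 := div_nonneg (by linarith) (by positivity)
    linarith
  have h4 : (t ^ 2 + 1 / t ^ 2) ^ 2 = (t ^ 2 - 1 / t ^ 2) ^ 2 + 4 := by field_simp; ring
  have h5 : Real.sqrt 5 ≤ t ^ 2 + 1 / t ^ 2 := by
    rw [Real.sqrt_le_left (by positivity), h4]
    nlinarith
  linarith

theorem add_one_lt_sq_of_lambdaStar_lt {t : ℝ} (ht : 1 ≤ t) (h : lambdaStar < t + 1 / t) :
    t ^ 2 + 1 < (t ^ 2) ^ 2 := by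
  have ht0 : 0 < t := by linarith
  have h1 : 2 + Real.sqrt 5 < (t + 1 / t) ^ 2 := by
    rw [← lambdaStar_sq]
    exact pow_lt_pow_left₀ h lambdaStar_nonneg two_ne_zero
  have h2 : (t + 1 / t) ^ 2 = t ^ 2 + 1 / t ^ 2 + 2 := by field_simp; ring
  by_contra! hle
  have h3 : t ^ 2 - 1 / t ^ 2 ≤ 1 := by
    have : t ^ 2 - 1 / t ^ 2 - 1 = ((t ^ 2) ^ 2 - (t ^ 2 + 1)) / t ^ 2 := by field_simp; ring
    have : ((t ^ 2) ^ 2 - (t ^ 2 + 1)) / t ^ 2 ≤ 0 :=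
      div_nonpos_of_nonpos_of_nonneg (by linarith) (by positivity)
    linarith
  have h3' : 0 ≤ t ^ 2 - 1 / t ^ 2 := by
    have h6 : 1 / t ^ 2 ≤ 1 := by
      rw [div_le_one (by positivity)]; nlinarith
    nlinarith
  have h4 : (t ^ 2 + 1 / t ^ 2) ^ 2 = (t ^ 2 - 1 / t ^ 2) ^ 2 + 4 := by field_simp; ring
  have h5 : t ^ 2 + 1 / t ^ 2 ≤ Real.sqrt 5 := by
    refine Real.le_sqrt_of_sq_le ?_
    rw [h4]
    nlinarith
  linarith

/-- The ratio of the last two entries of the solution of the eigenvalue equation on a path with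
`k` vertices. -/
def pathRatio (lam : ℝ) : ℕ → ℝ
  | 0 => 0
  | k + 1 => 1 / (lam - pathRatio lam k)

variable {t lam : ℝ}

theorem pathRatio_mem (ht : 1 ≤ t) (hlam : lam = t + 1 / t) (k : ℕ) :
    0 ≤ pathRatio lam k ∧ pathRatio lam k < 1 / t := by
  have ht0 : 0 < t := by linarith
  induction k with
  | zero => exact ⟨le_rfl, by simp only [pathRatio]; positivity⟩
  | succ k ih =>
    have h1 : t < lam - pathRatio lam k := by linarith [ih.2]
    exact ⟨by simp only [pathRatio]; exact div_nonneg one_pos.le (by linarith),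
      one_div_lt_one_div_of_lt ht0 h1⟩

theorem lt_sub_pathRatio (ht : 1 ≤ t) (hlam : lam = t + 1 / t) (k : ℕ) :
    t < lam - pathRatio lam k := by
  linarith [(pathRatio_mem ht hlam k).2]

theorem pathRatio_succ_sub (ht : 1 ≤ t) (hlam : lam = t + 1 / t) (k : ℕ) :
    pathRatio lam (k + 1) - pathRatio lam k =
      (t - pathRatio lam k) * (1 / t - pathRatio lam k) / (lam - pathRatio lam k) := by
  have ht0 : 0 < t := by linarith
  have h1 := lt_sub_pathRatio ht hlam k
  have h2 : lam - pathRatio lam k ≠ 0 := by linarith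
  simp only [pathRatio]
  rw [eq_div_iff h2, sub_mul, one_div_mul_cancel h2, hlam]
  field_simp
  ring

theorem one_div_le_self (ht : 1 ≤ t) : 1 / t ≤ t := by
  rw [div_le_iff₀ (by linarith)]; nlinarith

theorem pathRatio_mono (ht : 1 ≤ t) (hlam : lam = t + 1 / t) : Monotone (pathRatio lam) := by
  refine monotone_nat_of_le_succ fun k => ?_
  have h1 := lt_sub_pathRatio ht hlam k
  have h2 := (pathRatio_mem ht hlam k).2
  have h3 := one_div_le_self ht
  have := pathRatio_succ_sub ht hlam k
  have : 0 ≤ (t - pathRatio lam k) * (1 / t - pathRatio lam k) / (lam - pathRatio lam k) :=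
    div_nonneg (mul_nonneg (by linarith) (by linarith)) (by linarith)
  linarith

/-- As long as the ratios stay below `b < 1/t`, their increments are bounded below, so they would
grow linearly. -/
theorem exists_lt_pathRatio (ht : 1 ≤ t) (hlam : lam = t + 1 / t) {b : ℝ} (hb : b < 1 / t) :
    ∃ n, b < pathRatio lam n := by
  by_contra! hle
  have h3 := one_div_le_self ht
  have hlam0 : 0 < lam := by rw [hlam]; positivity
  set κ := (1 / t - b) ^ 2 / lam with hκ
  have hκ0 : 0 < κ := div_pos (pow_pos (by linarith) 2) hlam0
  have hstep : ∀ k, κ ≤ pathRatio lam (k + 1) - pathRatio lam k := by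
    intro k
    rw [pathRatio_succ_sub ht hlam]
    have h1 := lt_sub_pathRatio ht hlam k
    have h2 := pathRatio_mem ht hlam k
    have h4 := hle k
    refine div_le_div₀ (mul_nonneg (by linarith) (by linarith)) ?_ (by linarith) (by linarith)
    rw [sq]
    exact mul_le_mul (by linarith) (by linarith) (by linarith) (by linarith)
  have hlin : ∀ k : ℕ, k * κ ≤ pathRatio lam k := by
    intro k
    induction k with
    | zero => simp [pathRatio]
    | succ k ih => push_cast; linarith [hstep k]
  obtain ⟨k, hk⟩ := exists_nat_gt (b / κ)
  rw [div_lt_iff₀ hκ0] at hk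
  linarith [hlin k, hle k]

theorem pathRatio_closed (ht : 1 ≤ t) (hlam : lam = t + 1 / t) (m : ℕ) :
    pathRatio lam m * ((t ^ 2) ^ (m + 1) - 1) = t * ((t ^ 2) ^ m - 1) := by
  have ht0 : 0 < t := by linarith
  induction m with
  | zero => simp [pathRatio]
  | succ m ih =>
    have h1 := lt_sub_pathRatio ht hlam m
    have h2 : lam - pathRatio lam m ≠ 0 := by linarith
    simp only [pathRatio]
    rw [div_mul_eq_mul_div, div_eq_iff h2, one_mul]
    have h3 : t * lam = t ^ 2 + 1 := by rw [hlam]; field_simp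
    calc (t ^ 2) ^ (m + 1 + 1) - 1 = (t * lam) * ((t ^ 2) ^ (m + 1) - 1)
          - t * (t * ((t ^ 2) ^ m - 1)) := by rw [h3]; ring
      _ = _ := by rw [← ih]; ring

/-- The slack at the branch vertex of the infinite spider with legs of lengths `1`, `m`, `∞`. -/
theorem spider_slack (ht : 1 < t) (hlam : lam = t + 1 / t) (m : ℕ) :
    (t - pathRatio lam m - 1 / lam) * ((t ^ 2 + 1) * ((t ^ 2) ^ (m + 1) - 1)) =
      t * (t ^ 2 - 1) * ((t ^ 2) ^ (m + 1) - ∑ i ∈ range m, (t ^ 2) ^ i) := by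
  have ht0 : 0 < t := by linarith
  have h1 := pathRatio_closed ht.le hlam m
  have h2 : (t ^ 2 - 1) * ∑ i ∈ range m, (t ^ 2) ^ i = (t ^ 2) ^ m - 1 := mul_geom_sum _ _
  have h3 : 1 / lam * (t ^ 2 + 1) = t := by rw [hlam]; field_simp
  calc _ = t * (t ^ 2 + 1) * ((t ^ 2) ^ (m + 1) - 1)
        - (t ^ 2 + 1) * (pathRatio lam m * ((t ^ 2) ^ (m + 1) - 1))
        - (1 / lam * (t ^ 2 + 1)) * ((t ^ 2) ^ (m + 1) - 1) := by ring
    _ = t * ((t ^ 2 - 1) * (t ^ 2) ^ (m + 1) - ((t ^ 2) ^ m - 1)) := by rw [h1, h3]; ring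
    _ = _ := by rw [← h2]; ring

end Param

/-! ### The roots `beta m` and the critical values `alpha m`. -/

section Beta

/-- Passing from `a` to `b` multiplies the lower powers by smaller factors than the top power. This
gives both uniqueness of the positive root and the sign beyond it. -/
theorem sum_pow_lt_pow_of_lt {a b : ℝ} {m : ℕ} (hm : 1 ≤ m) (ha : 0 < a) (hab : a < b)
    (h : a ^ (m + 1) = ∑ i ∈ range m, a ^ i) : ∑ i ∈ range m, b ^ i < b ^ (m + 1) := by
  have h1 : 1 < b / a := (one_lt_div ha).2 hab
  calc ∑ i ∈ range m, b ^ i = ∑ i ∈ range m, a ^ i * (b / a) ^ i :=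
        Finset.sum_congr rfl fun i _ => by rw [← mul_pow, mul_div_cancel₀ _ ha.ne']
    _ < ∑ i ∈ range m, a ^ i * (b / a) ^ (m + 1) := by
        refine Finset.sum_lt_sum_of_nonempty (nonempty_range_iff.2 (by omega)) fun i hi => ?_
        have := Finset.mem_range.1 hi
        exact mul_lt_mul_of_pos_left (pow_lt_pow_right₀ h1 (by omega)) (by positivity)
    _ = b ^ (m + 1) := by
        rw [← Finset.sum_mul, ← h, ← mul_pow, mul_div_cancel₀ _ ha.ne']

theorem one_le_beta {m : ℕ} (hm : 1 ≤ m) : 1 ≤ beta m := by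
  have hm' : (1 : ℝ) ≤ m := by exact_mod_cast hm
  have hc : ContinuousOn (fun x : ℝ => x ^ (m + 1) - ∑ i ∈ range m, x ^ i)
      (Set.Icc 1 m) := by fun_prop
  have h0 : (0 : ℝ) ∈ Set.Icc ((1 : ℝ) ^ (m + 1) - ∑ i ∈ range m, (1 : ℝ) ^ i)
      ((m : ℝ) ^ (m + 1) - ∑ i ∈ range m, (m : ℝ) ^ i) := by
    refine ⟨by simp [hm'], ?_⟩
    have : ∑ i ∈ range m, (m : ℝ) ^ i ≤ ∑ _i ∈ range m, (m : ℝ) ^ m :=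
      Finset.sum_le_sum fun i hi => pow_le_pow_right₀ hm' (Finset.mem_range.1 hi).le
    simp only [sum_const, card_range, nsmul_eq_mul] at this
    rw [pow_succ, mul_comm]
    linarith
  obtain ⟨x, hx1, hx⟩ := intermediate_value_Icc hm' hc h0
  exact hx1.1.trans ((isGreatest_beta m hm).2 (sub_eq_zero.1 hx))

theorem one_lt_beta {m : ℕ} (hm : 2 ≤ m) : 1 < beta m := by
  refine (one_le_beta (by omega)).lt_of_ne fun h => ?_
  have h1 := (isGreatest_beta m (by omega)).1
  rw [Set.mem_ofPred_eq, ← h] at h1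
  simp only [one_pow, sum_const, card_range, nsmul_eq_mul, mul_one] at h1
  have : m = 1 := by exact_mod_cast h1.symm
  omega

theorem eq_beta {m : ℕ} (hm : 1 ≤ m) {x : ℝ} (hx : 0 < x)
    (h : x ^ (m + 1) = ∑ i ∈ range m, x ^ i) : x = beta m := by
  have hg := isGreatest_beta m hm
  refine (hg.2 h).antisymm (not_lt.1 fun hlt => ?_)
  have h1 := sum_pow_lt_pow_of_lt hm hx hlt h
  have h2 : beta m ^ (m + 1) = ∑ i ∈ range m, beta m ^ i := hg.1
  linarith

theorem alpha_eq {m : ℕ} {t : ℝ} (ht : 0 < t) (h : t ^ 2 = beta m) : alpha m = t + 1 / t := by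
  have h1 : beta m ^ (1 / 2 : ℝ) = t := by
    rw [← Real.sqrt_eq_rpow, ← h, Real.sqrt_sq ht.le]
  have h2 : beta m ^ (-(1 / 2) : ℝ) = 1 / t := by
    rw [Real.rpow_neg (by rw [← h]; positivity), h1, one_div]
  rw [alpha, h1, h2]

/-- Zero slack in the spider with legs `1`, `m`, `∞` means that `lam = alpha m`. -/
theorem eq_alpha_of_slack_eq_zero {t lam : ℝ} (ht : 1 < t) (hlam : lam = t + 1 / t) {m : ℕ}
    (hm : 1 ≤ m) (h : pathRatio lam m + 1 / lam + 1 / t = lam) : lam = alpha m := by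
  have h1 := spider_slack ht hlam m
  rw [show t - pathRatio lam m - 1 / lam = 0 by linarith, zero_mul] at h1
  have h2 : t * (t ^ 2 - 1) ≠ 0 := by
    have : 0 < t ^ 2 - 1 := by nlinarith
    positivity
  have h3 := (mul_eq_zero.1 h1.symm).resolve_left h2
  rw [alpha_eq (by linarith) (eq_beta hm (by positivity) (sub_eq_zero.1 h3)), hlam]

theorem slack_eq_zero_of_beta {t lam : ℝ} (ht : 1 < t) (hlam : lam = t + 1 / t) {m : ℕ}
    (hm : 1 ≤ m) (h : t ^ 2 = beta m) : t - pathRatio lam m - 1 / lam = 0 := by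
  have h1 := spider_slack ht hlam m
  have h2 : beta m ^ (m + 1) = ∑ i ∈ range m, beta m ^ i := (isGreatest_beta m hm).1
  rw [h, sub_eq_zero.2 h2, mul_zero, ← h] at h1
  refine (mul_eq_zero.1 h1).resolve_right ?_
  have : 1 < (t ^ 2) ^ (m + 1) := one_lt_pow₀ (by nlinarith) (by omega)
  exact mul_ne_zero (by positivity) (by linarith)

theorem slack_pos_of_beta_lt {t lam : ℝ} (ht : 1 < t) (hlam : lam = t + 1 / t) {m : ℕ}
    (hm : 1 ≤ m) (h : beta m < t ^ 2) : 0 < t - pathRatio lam m - 1 / lam := by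
  have h1 := spider_slack ht hlam m
  have h2 : beta m ^ (m + 1) = ∑ i ∈ range m, beta m ^ i := (isGreatest_beta m hm).1
  have h3 := sum_pow_lt_pow_of_lt hm (by linarith [one_le_beta hm]) h h2
  have h4 : 1 < (t ^ 2) ^ (m + 1) := one_lt_pow₀ (by nlinarith) (by omega)
  have h5 : 0 < (t ^ 2 + 1) * ((t ^ 2) ^ (m + 1) - 1) := mul_pos (by positivity) (by linarith)
  have h6 : 0 < t * (t ^ 2 - 1) * ((t ^ 2) ^ (m + 1) - ∑ i ∈ range m, (t ^ 2) ^ i) :=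
    mul_pos (mul_pos (by linarith) (by nlinarith)) (by linarith)
  rw [← h1] at h6
  exact pos_of_mul_pos_left h6 h5.le

end Beta

/-! ### Each `alpha m` with `m ≥ 2` is a right limit point. -/

section LimitAlpha
open RootedGraph

/-- The path has `m + 1` vertices: its root carries a leg of `m` vertices. -/
theorem eval_path {t lam : ℝ} (ht : 1 ≤ t) (hlam : lam = t + 1 / t) (m : ℕ) :
    (extend^[m] point).Eval lam (lam - pathRatio lam m) 1 := by
  induction m with
  | zero => simpa [pathRatio] using eval_point lam
  | succ m ih =>
    rw [Function.iterate_succ_apply']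
    have h1 := lt_sub_pathRatio ht hlam m
    refine (ih.extend (by linarith)).mono ?_
    have : 0 ≤ 1 / (lam - pathRatio lam m) ^ 2 := by positivity
    linarith

/-- The defect `1/t` is a fixed point of `c ↦ lam - 1/c`, so a critical graph stays critical when
its leg grows. -/
theorem eval_extend_iterate_fixed {t lam q : ℝ} (ht : 0 < t) (hlam : lam = t + 1 / t)
    {A : RootedGraph} (h : A.Eval lam (1 / t) q) (k : ℕ) :
    (extend^[k] A).Eval lam (1 / t) 0 := by
  induction k with
  | zero => exact h.norm_zero
  | succ k ih =>
    rw [Function.iterate_succ_apply']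
    have h1 := ih.extend (by positivity)
    rw [show lam - 1 / (1 / t) = 1 / t by rw [one_div_one_div, hlam]; ring] at h1
    exact h1.norm_zero

/-- Between the fixed points `1/t` and `t` the map `c ↦ lam - 1/c` moves upwards, with step at least
`κ` while the defect is at most `b`. -/
theorem exists_eval_extend_iterate {t lam c q b : ℝ} (ht : 0 < t) (hlam : lam = t + 1 / t)
    {A : RootedGraph} (h : A.Eval lam c q) (hc : 1 / t < c) (hb : b < t) :
    ∃ k c', b < c' ∧ (extend^[k] A).Eval lam c' 0 := by
  have hc0 : 0 < c := lt_trans (by positivity) hc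
  have h0 := h.norm_zero
  by_contra! hcon
  have hcb : c ≤ b := not_lt.1 fun hlt => hcon 0 c hlt h0
  set κ := (t - b) * (c - 1 / t) / b with hκ
  have hκ0 : 0 < κ := div_pos (mul_pos (by linarith) (by linarith)) (by linarith)
  have key : ∀ k : ℕ, ∃ c', c + k * κ ≤ c' ∧ (extend^[k] A).Eval lam c' 0 := by
    intro k
    induction k with
    | zero => exact ⟨c, by simp, h0⟩
    | succ k ih =>
      obtain ⟨c', h1, h2⟩ := ih
      have h3 : c ≤ c' := le_trans (by have : 0 ≤ k * κ := by positivity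
                                       linarith) h1
      have h4 : 0 < c' := by linarith
      have h5 : c' ≤ b := not_lt.1 fun hlt => hcon k c' hlt h2
      refine ⟨lam - 1 / c', ?_, ?_⟩
      · have h6 : lam - 1 / c' - c' = (t - c') * (c' - 1 / t) / c' := by
          rw [hlam]; field_simp; ring
        have h7 : κ ≤ (t - c') * (c' - 1 / t) / c' :=
          div_le_div₀ (mul_nonneg (by linarith) (by linarith))
            (mul_le_mul (by linarith) (by linarith) (by linarith) (by linarith)) h4 h5
        push_cast; linarith
      · rw [Function.iterate_succ_apply']
        exact (h2.extend h4).norm_zero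
  obtain ⟨k, hk⟩ := exists_nat_gt (b / κ)
  rw [div_lt_iff₀ hκ0] at hk
  obtain ⟨c', h1, h2⟩ := key k
  exact hcon k c' (by linarith) h2

/-- At `alpha m` the defect at the end of the growing leg is always `1/t`, less than the cost
`2/lam` of two leaves, so the radius exceeds `alpha m`. At `lam + ε / 2` the slack is positive and a
long enough leg can afford both leaves. -/
theorem alpha_mem_rightLimitPoints {m : ℕ} (hm : 2 ≤ m) :
    alpha m ∈ rightLimitPoints spectralRadii := by
  intro ε hε
  have hm1 : 1 ≤ m := by omega
  have hβ := one_lt_beta hm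
  obtain ⟨t, ht0, htβ⟩ : ∃ t : ℝ, 0 < t ∧ t ^ 2 = beta m :=
    ⟨Real.sqrt (beta m), Real.sqrt_pos.2 (by linarith), Real.sq_sqrt (by linarith)⟩
  have ht : 1 < t := by nlinarith
  have hα := alpha_eq ht0 htβ
  set lam := alpha m with hlamdef
  obtain ⟨s, hs1, hs⟩ := exists_add_inv_eq (lam := lam + ε / 2) (by
    rw [hα]
    have : (t - 1) ^ 2 / t ≥ 0 := by positivity
    have h2 : t + 1 / t - 2 = (t - 1) ^ 2 / t := by field_simp; ring
    linarith)
  have hts : t < s := lt_of_add_inv_lt hs1 (by rw [← hα, ← hs]; linarith) ht.le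
  have hs1' : 1 < s := ht.trans hts
  have hlam0 : 0 < lam := by rw [hα]; positivity
  have hmu0 : 0 < lam + ε / 2 := by positivity
  -- evaluation at the two values of the spider with a long leg
  have e1 := (eval_path ht.le hα m).addLeaf hlam0
  have e2 := (eval_path hs1 hs m).addLeaf hmu0
  have d1 := slack_eq_zero_of_beta ht hα hm1 htβ
  have d2 := slack_pos_of_beta_lt hs1' hs hm1 (by nlinarith)
  rw [show lam - pathRatio lam m - 1 / lam = 1 / t by linarith] at e1
  -- The target `2 / (lam + ε / 2)` is the cost of the two final leaves; it is below `s` because `s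
  -- > 1`.
  obtain ⟨k, c, hc, e3⟩ := exists_eval_extend_iterate (b := 2 / (lam + ε / 2))
    (by linarith) hs e2 (by linarith) (by
      rw [hs, div_lt_iff₀ (by positivity)]
      have : s * (s + 1 / s) = s ^ 2 + 1 := by field_simp
      rw [this]; nlinarith)
  have e4 := eval_extend_iterate_fixed ht0 hα e1 k
  have f1 := (e4.addLeaf hlam0).addLeaf hlam0
  have f2 := (e3.addLeaf hmu0).addLeaf hmu0
  refine ⟨_, ⟨f1.lt_spectralRadius ?_, ?_⟩, spectralRadius_mem_spectralRadii _⟩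
  · have h1 : 1 / t < 2 / lam := by
      rw [div_lt_div_iff₀ ht0 hlam0, hα]
      have : 1 / t < t := by rw [div_lt_iff₀ ht0]; nlinarith
      linarith
    have h2 : 2 / lam = 1 / lam + 1 / lam := by ring
    linarith
  · have h2 : 2 / (lam + ε / 2) = 1 / (lam + ε / 2) + 1 / (lam + ε / 2) := by ring
    have := f2.spectralRadius_le (by linarith)
    linarith

end LimitAlpha

/-! ### Greedy caterpillars above `λ*`. -/

section Shearer
open RootedGraph

variable {t lam : ℝ}

/-- The largest number of leaves that can be attached to a vertex with defect `y` so that the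
remaining defect is at least `1 / t`. -/
def leafCount (t lam y : ℝ) : ℕ := ⌊lam * (y - 1 / t)⌋₊

theorem sub_leafCount_mem (hlam : 0 < lam) {y : ℝ} (hy : 1 / t ≤ y) :
    1 / t ≤ y - leafCount t lam y / lam ∧ y - leafCount t lam y / lam < 1 / t + 1 / lam := by
  have h0 : 0 ≤ lam * (y - 1 / t) := mul_nonneg hlam.le (by linarith)
  have h1 := Nat.floor_le h0
  have h2 := Nat.lt_floor_add_one (lam * (y - 1 / t))
  rw [leafCount]
  constructor
  · have : (⌊lam * (y - 1 / t)⌋₊ : ℝ) / lam ≤ y - 1 / t := by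
      rw [div_le_iff₀ hlam]; linarith
    linarith
  · have : y - 1 / t < ((⌊lam * (y - 1 / t)⌋₊ : ℝ) + 1) / lam := by
      rw [lt_div_iff₀ hlam]; linarith
    rw [add_div] at this
    linarith

/-- The defects along the greedy caterpillar. -/
def greedyDefect (t lam : ℝ) : ℕ → ℝ
  | 0 => lam - leafCount t lam lam / lam
  | k + 1 => (lam - 1 / greedyDefect t lam k) -
      leafCount t lam (lam - 1 / greedyDefect t lam k) / lam

/-- The greedy caterpillar. -/
def greedyGraph (t lam : ℝ) : ℕ → RootedGraph
  | 0 => addLeaf^[leafCount t lam lam] point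
  | k + 1 => addLeaf^[leafCount t lam (lam - 1 / greedyDefect t lam k)] (greedyGraph t lam k).extend

/-- The values of the eigenvector along the spine of the greedy caterpillar. -/
def greedyValue (t lam : ℝ) (k : ℕ) : ℝ := ∏ j ∈ range k, greedyDefect t lam j

theorem greedyDefect_mem (ht : 1 ≤ t) (hlam : lam = t + 1 / t) (k : ℕ) :
    1 / t ≤ greedyDefect t lam k ∧ greedyDefect t lam k < 1 / t + 1 / lam := by
  have ht0 : 0 < t := by linarith
  have hlam0 : 0 < lam := by rw [hlam]; positivity
  induction k with
  | zero => exact sub_leafCount_mem hlam0 (by linarith)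
  | succ k ih =>
    refine sub_leafCount_mem hlam0 ?_
    have : 1 / greedyDefect t lam k ≤ t := by
      rw [one_div_le (lt_of_lt_of_le (by positivity) ih.1) ht0]; exact ih.1
    linarith

theorem greedyDefect_pos (ht : 1 ≤ t) (hlam : lam = t + 1 / t) (k : ℕ) :
    0 < greedyDefect t lam k :=
  lt_of_lt_of_le (by positivity) (greedyDefect_mem ht hlam k).1

theorem greedyValue_pos (ht : 1 ≤ t) (hlam : lam = t + 1 / t) (k : ℕ) :
    0 < greedyValue t lam k :=
  Finset.prod_pos fun j _ => greedyDefect_pos ht hlam j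

theorem eval_greedyGraph (ht : 1 ≤ t) (hlam : lam = t + 1 / t) (k : ℕ) :
    (greedyGraph t lam k).Eval lam (greedyDefect t lam k)
      ((∑ j ∈ range (k + 1), greedyValue t lam j ^ 2) / greedyValue t lam k ^ 2) := by
  have hlam0 : 0 < lam := by rw [hlam]; positivity
  induction k with
  | zero =>
    simpa [greedyValue, greedyGraph, greedyDefect] using (eval_point lam).addLeaf_iterate hlam0 _
  | succ k ih =>
    have hc := greedyDefect_pos ht hlam k
    have hg := greedyValue_pos ht hlam k
    have h1 := (ih.extend hc).addLeaf_iterate hlam0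
      (leafCount t lam (lam - 1 / greedyDefect t lam k))
    refine h1.mono (le_of_eq ?_)
    have h2 : greedyValue t lam (k + 1) = greedyValue t lam k * greedyDefect t lam k :=
      Finset.prod_range_succ _ _
    rw [Finset.sum_range_succ _ (k + 1), h2]
    field_simp
    ring

/-- Attaching leaves greedily does not increase the energy. -/
theorem energy_step (ht : 1 ≤ t) (hlam : lam = t + 1 / t) (hx : t ^ 2 + 1 ≤ (t ^ 2) ^ 2)
    {c : ℝ} (hc : 0 < c) (hc' : c < 1 / t + 1 / lam) {d : ℕ} :
    c ^ 2 * ((t - (lam - 1 / c - d / lam)) * ((lam - 1 / c - d / lam) - 1 / t)) ≤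
      (t - c) * (c - 1 / t) := by
  have ht0 : 0 < t := by linarith
  have hlam0 : 0 < lam := by rw [hlam]; positivity
  have hq : ∀ z, (t - z) * (z - 1 / t) = lam * z - z ^ 2 - 1 := by
    intro z; rw [hlam]; field_simp; ring
  -- Here `t²` being at least the golden ratio enters. If at least one leaf is attached, the
  -- midpoint of the defects before and after is at most `lam / 2`, the axis of the energy parabola.
  have hy : lam - 1 / c ≤ (lam + 1 / lam) / 2 := by
    have h1 : 1 / (1 / t + 1 / lam) ≤ 1 / c := one_div_le_one_div_of_le hc hc'.le
    have h2 : lam - 1 / (1 / t + 1 / lam) ≤ (lam + 1 / lam) / 2 := by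
      have h3 : 0 < t + lam := by positivity
      have h4 : 1 / (1 / t + 1 / lam) = t * lam / (t + lam) := by field_simp; ring
      rw [h4, sub_le_iff_le_add, ← sub_nonneg]
      have h5 : (lam + 1 / lam) / 2 + t * lam / (t + lam) - lam =
          (t * (lam ^ 2 + 1) - lam * (lam ^ 2 - 1)) / (2 * lam * (t + lam)) := by
        field_simp; ring
      rw [h5]
      refine div_nonneg ?_ (by positivity)
      have h6 : t * (lam ^ 2 + 1) - lam * (lam ^ 2 - 1) = ((t ^ 2) ^ 2 - (t ^ 2 + 1)) / t ^ 3 := by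
        rw [hlam]; field_simp; ring
      rw [h6]
      exact div_nonneg (by linarith) (by positivity)
    linarith
  -- Without leaves the form `lam x y - x² - y²` in consecutive spine values is conserved.
  have h7 : c ^ 2 * ((t - (lam - 1 / c)) * ((lam - 1 / c) - 1 / t)) = (t - c) * (c - 1 / t) := by
    rw [hq, hq]; field_simp; ring
  rw [← h7]
  refine mul_le_mul_of_nonneg_left ?_ (by positivity)
  rw [hq, hq]
  set y := lam - 1 / c
  have h8 : lam * (y - d / lam) - (y - d / lam) ^ 2 - 1 =
      lam * y - y ^ 2 - 1 - d / lam * (lam - (2 * y - d / lam)) := by ring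
  rw [h8]
  suffices 0 ≤ d / lam * (lam - (2 * y - d / lam)) by linarith
  rcases Nat.eq_zero_or_pos d with rfl | hd
  · simp
  · have h9 : 1 / lam ≤ d / lam := by
      have : (1 : ℝ) ≤ d := by exact_mod_cast hd
      gcongr
    exact mul_nonneg (by positivity) (by linarith)

/-- Otherwise the bound on `D` makes `∑ g²` converge, so `g → 0` and the second bound drives `D`
below `η * g 0 ^ 2`, a contradiction. -/
theorem exists_small_ratio {D g : ℕ → ℝ} {C K : ℝ} (hg : ∀ k, 0 < g k)
    (hC : ∀ k, D k ≤ C) (hK : ∀ k, D k ≤ K * g k ^ 2) {η : ℝ} (hη : 0 < η) :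
    ∃ k, D k < η * ∑ j ∈ range (k + 1), g j ^ 2 := by
  by_contra! hcon
  have hK0 : 0 < K := by
    have h1 := (hcon 0).trans (hK 0)
    have h2 : 0 < g 0 ^ 2 := pow_pos (hg 0) 2
    simp only [zero_add, sum_range_one] at h1
    nlinarith
  have hsum : Summable fun k => g k ^ 2 := by
    refine summable_of_sum_range_le (c := C / η) (fun k => sq_nonneg _) fun n => ?_
    rw [le_div_iff₀ hη, mul_comm]
    rcases n with _ | n
    · have h1 := (hcon 0).trans (hC 0)
      have h2 : 0 < g 0 ^ 2 := pow_pos (hg 0) 2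
      simp only [zero_add, sum_range_one] at h1
      simp only [range_zero, sum_empty, mul_zero]
      nlinarith
    · exact (hcon n).trans (hC n)
  have hlim := hsum.tendsto_atTop_zero
  have hpos : 0 < η * g 0 ^ 2 / K := div_pos (mul_pos hη (pow_pos (hg 0) 2)) hK0
  obtain ⟨k, hk⟩ := (hlim.eventually_lt_const hpos).exists
  rw [lt_div_iff₀ hK0] at hk
  have h1 : g 0 ^ 2 ≤ ∑ j ∈ range (k + 1), g j ^ 2 :=
    Finset.single_le_sum (f := fun j => g j ^ 2) (fun j _ => sq_nonneg _) (by simp)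
  have h2 := (hcon k).trans (hK k)
  nlinarith

/-- Every number above `λ*` is approximated from below by spectral radii of caterpillars. -/
theorem exists_spectralRadius_mem_Icc (h : lambdaStar < lam) {δ : ℝ} (hδ : 0 < δ) :
    ∃ A : RootedGraph, lam - δ ≤ spectralRadius A.graph ∧ spectralRadius A.graph ≤ lam := by
  obtain ⟨t, ht, hlam⟩ := exists_add_inv_eq (two_le_lambdaStar.trans h.le)
  have hx := add_one_lt_sq_of_lambdaStar_lt ht (hlam ▸ h)
  have ht0 : 0 < t := by linarith
  have hlam0 : 0 < lam := by rw [hlam]; positivity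
  set c := greedyDefect t lam
  set g := greedyValue t lam
  set e := t - (1 / t + 1 / lam) with he
  have he0 : 0 < e := by
    have : e = ((t ^ 2) ^ 2 - (t ^ 2 + 1)) / (t * (t ^ 2 + 1)) := by
      rw [he, hlam]; field_simp; ring
    rw [this]
    exact div_pos (by linarith) (by positivity)
  have hmem := fun k => greedyDefect_mem ht hlam k
  have hg := fun k => greedyValue_pos ht hlam k
  have henergy : ∀ k, g k ^ 2 * ((t - c k) * (c k - 1 / t)) ≤ (t - c 0) * (c 0 - 1 / t) := by
    intro k
    induction k with
    | zero => simp [g, greedyValue]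
    | succ k ih =>
      refine le_trans ?_ ih
      have h2 : g (k + 1) = g k * c k := Finset.prod_range_succ _ _
      rw [h2, mul_pow, mul_assoc]
      exact mul_le_mul_of_nonneg_left
        (energy_step ht hlam hx.le (greedyDefect_pos ht hlam k) (hmem k).2) (sq_nonneg _)
  -- The energy bound and `t - c k ≥ e > 0` bound the excess `(c k - 1 / t) * g k ^ 2`, so for some
  -- `k` it is small against the accumulated squared norm.
  obtain ⟨k, hk⟩ := exists_small_ratio (D := fun k => (c k - 1 / t) * g k ^ 2) (g := g)
    (C := (t - c 0) * (c 0 - 1 / t) / e) (K := 1 / lam) hg (fun k => by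
      rw [le_div_iff₀ he0]
      refine le_trans ?_ (henergy k)
      have h1 : 0 ≤ (c k - 1 / t) * g k ^ 2 := mul_nonneg (by linarith [(hmem k).1]) (sq_nonneg _)
      have h2 : e ≤ t - c k := by rw [he]; linarith [(hmem k).2]
      calc (c k - 1 / t) * g k ^ 2 * e ≤ (c k - 1 / t) * g k ^ 2 * (t - c k) :=
            mul_le_mul_of_nonneg_left h2 h1
        _ = _ := by ring)
    (fun k => mul_le_mul_of_nonneg_right (by linarith [(hmem k).2]) (sq_nonneg _)) hδ
  set q := (∑ j ∈ range (k + 1), g j ^ 2) / g k ^ 2 with hq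
  have hk' : c k - 1 / t < δ * q := by
    rw [hq, mul_div_assoc', lt_div_iff₀ (pow_pos (hg k) 2)]; exact hk
  -- A long pendant path consumes almost `1/t`, leaving a positive defect below `δ * q`.
  obtain ⟨n, hn⟩ := exists_lt_pathRatio ht hlam (b := c k - δ * q) (by linarith)
  have hn' := hn.trans_le (pathRatio_mono ht hlam n.le_succ)
  have h1 := (eval_greedyGraph ht hlam k).join (eval_path ht hlam n)
    (by linarith [lt_sub_pathRatio ht hlam n])
  have h2 := h1.mono (p := q) (by
    have : 0 ≤ 1 / (lam - pathRatio lam n) ^ 2 := by positivity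
    linarith)
  change Eval _ lam (c k - pathRatio lam (n + 1)) q at h2
  refine ⟨_, h2.sub_le_spectralRadius hδ.le (by linarith), h2.spectralRadius_le ?_⟩
  linarith [(pathRatio_mem ht hlam (n + 1)).2, (hmem k).1]

theorem mem_rightLimitPoints_of_lambdaStar_le (h : lambdaStar ≤ lam) :
    lam ∈ rightLimitPoints spectralRadii := by
  intro ε hε
  -- Approximating a number strictly above `lam` also covers `lam = λ*`.
  obtain ⟨A, h1, h2⟩ := exists_spectralRadius_mem_Icc (lam := lam + ε / 2) (by linarith)
    (δ := ε / 4) (by linarith)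
  exact ⟨_, ⟨by linarith, by linarith⟩, spectralRadius_mem_spectralRadii A⟩

end Shearer

theorem two_le_alpha {m : ℕ} (hm : 2 ≤ m) : 2 ≤ alpha m := by
  have hβ := one_lt_beta hm
  have ht0 : 0 < Real.sqrt (beta m) := Real.sqrt_pos.2 (by linarith)
  rw [alpha_eq ht0 (Real.sq_sqrt (by linarith))]
  set t := Real.sqrt (beta m)
  have h1 : (t - 1) ^ 2 / t ≥ 0 := by positivity
  have h2 : t + 1 / t - 2 = (t - 1) ^ 2 / t := by field_simp; ring
  linarith

theorem infinite_forbidden_and_limit {lam : ℝ}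
    (h : (∃ m : ℕ, 2 ≤ m ∧ lam = alpha m) ∨ lambdaStar ≤ lam) :
    (¬ ∃ 𝒢 : Set FinGraph, 𝒢.Finite ∧ (∀ G ∈ 𝒢, lam < spectralRadius G.graph) ∧
        family lam = connectedAvoiding 𝒢) ∧ lam ∈ rightLimitPoints spectralRadii := by
  have h1 : lam ∈ rightLimitPoints spectralRadii := by
    rcases h with ⟨m, hm, rfl⟩ | h
    · exact alpha_mem_rightLimitPoints hm
    · exact mem_rightLimitPoints_of_lambdaStar_le h
  have h0 : 0 ≤ lam := by
    rcases h with ⟨m, hm, rfl⟩ | h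
    · linarith [two_le_alpha hm]
    · exact lambdaStar_nonneg.trans h
  exact ⟨not_exists_finite_of_mem_rightLimitPoints h0 h1, h1⟩

set_option linter.unusedSectionVars false

/-! ### Local certificates, balls and longest paths. -/

section Local
variable {V : Type*} [Fintype V]

open Classical in
/-- Every connected induced subgraph on at most `B` vertices has a positive vector that certifies
that its spectral radius is at most `lam`. -/
def IsLocallyBounded (H : SimpleGraph V) (lam : ℝ) (B : ℕ) : Prop :=
  ∀ S : Finset V, (H.induce (S : Set V)).Connected → #S ≤ B →
    ∃ x : V → ℝ, (∀ v, 0 < x v) ∧ ∀ w ∈ S, ∑ u ∈ S with H.Adj w u, x u ≤ lam * x w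

open Classical in
theorem sum_le_nbSum (H : SimpleGraph V) {x : V → ℝ} (hx : ∀ v, 0 < x v) {v : V} {s : Finset V}
    (hs : ∀ u ∈ s, H.Adj v u) : ∑ u ∈ s, x u ≤ nbSum H x v :=
  Finset.sum_le_sum_of_subset_of_nonneg (fun u hu => by simpa using hs u hu)
    fun u _ _ => (hx u).le

theorem add_le_nbSum (H : SimpleGraph V) {x : V → ℝ} (hx : ∀ v, 0 < x v) {v a b : V}
    (ha : H.Adj v a) (hb : H.Adj v b) (hab : a ≠ b) : x a + x b ≤ nbSum H x v := by
  classical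
  rw [← Finset.sum_pair hab]
  exact sum_le_nbSum H hx (by simp [ha, hb])

theorem add_add_le_nbSum (H : SimpleGraph V) {x : V → ℝ} (hx : ∀ v, 0 < x v) {v a b c : V}
    (ha : H.Adj v a) (hb : H.Adj v b) (hc : H.Adj v c) (hab : a ≠ b) (hac : a ≠ c)
    (hbc : b ≠ c) : x a + x b + x c ≤ nbSum H x v := by
  classical
  have h : ∑ u ∈ {a, b, c}, x u = x a + x b + x c := by
    rw [Finset.sum_insert (by simp [hab, hac]), Finset.sum_pair hbc]; ring
  rw [← h]
  exact sum_le_nbSum H hx (by simp [ha, hb, hc])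

theorem add_add_add_le_nbSum (H : SimpleGraph V) {x : V → ℝ} (hx : ∀ v, 0 < x v)
    {v a b c d : V} (ha : H.Adj v a) (hb : H.Adj v b) (hc : H.Adj v c) (hd : H.Adj v d)
    (hab : a ≠ b) (hac : a ≠ c) (had : a ≠ d) (hbc : b ≠ c) (hbd : b ≠ d) (hcd : c ≠ d) :
    x a + x b + x c + x d ≤ nbSum H x v := by
  classical
  have h : ∑ u ∈ {a, b, c, d}, x u = x a + x b + x c + x d := by
    rw [Finset.sum_insert (by simp [hab, hac, had]), Finset.sum_insert (by simp [hbc, hbd]),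
      Finset.sum_pair hcd]; ring
  rw [← h]
  exact sum_le_nbSum H hx (by simp [ha, hb, hc, hd])

theorem induce_singleton_connected (H : SimpleGraph V) (v : V) :
    (H.induce ((({v} : Finset V) : Set V))).Connected := by
  rw [SimpleGraph.connected_iff_exists_forall_reachable]
  refine ⟨⟨v, by simp⟩, ?_⟩
  rintro ⟨w, hw⟩
  have : w = v := by simpa using hw
  subst this
  rfl

theorem IsLocallyBounded.nonneg {H : SimpleGraph V} {lam : ℝ} {B : ℕ} (h : IsLocallyBounded H lam B)
    (hB : 1 ≤ B) (v : V) : 0 ≤ lam := by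
  classical
  obtain ⟨x, hx, h1⟩ := h {v} (induce_singleton_connected H v) (by simpa using hB)
  have h2 := h1 v (by simp)
  have h3 : 0 ≤ lam * x v := le_trans (Finset.sum_nonneg fun u _ => (hx u).le) h2
  exact nonneg_of_mul_nonneg_left h3 (hx v)

-- The star with five leaves has radius `√5 > λ*` and six vertices.
open Classical in
theorem IsLocallyBounded.degree_le {H : SimpleGraph V} {lam : ℝ} {B : ℕ}
    (h : IsLocallyBounded H lam B) (hB : 6 ≤ B) (hlam : lam < lambdaStar) (v : V) :
    #{u | H.Adj v u} ≤ 4 := by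
  by_contra! hdeg
  obtain ⟨T, hT, hT5⟩ := Finset.exists_subset_card_eq (Nat.succ_le_of_lt hdeg)
  have hadj : ∀ u ∈ T, H.Adj v u := fun u hu => by simpa using hT hu
  have hvT : v ∉ T := fun hv => H.loopless.irrefl v (hadj v hv)
  have hconn : (H.induce ((insert v T : Finset V) : Set V)).Connected := by
    rw [SimpleGraph.connected_iff_exists_forall_reachable]
    refine ⟨⟨v, by simp⟩, ?_⟩
    rintro ⟨w, hw⟩
    rcases Finset.mem_insert.1 (Finset.mem_coe.1 hw) with rfl | hwT
    · rfl
    · exact SimpleGraph.Adj.reachable (by simpa using hadj w hwT)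
  obtain ⟨x, hx, h1⟩ := h (insert v T) hconn (by rw [Finset.card_insert_of_notMem hvT]; omega)
  have h0 := h.nonneg (by omega) v
  have h2 : ∑ u ∈ T, x u ≤ lam * x v := by
    refine le_trans ?_ (h1 v (by simp))
    refine Finset.sum_le_sum_of_subset_of_nonneg (fun u hu => ?_) fun u _ _ => (hx u).le
    simp [hadj u hu, hu]
  have h3 : ∀ u ∈ T, x v ≤ lam * x u := fun u hu => by
    refine le_trans ?_ (h1 u (by simp [hu]))
    exact Finset.single_le_sum (f := x) (fun i _ => (hx i).le) (by simp [(hadj u hu).symm])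
  have h4 : (5 : ℝ) * x v ≤ lam * ∑ u ∈ T, x u := by
    rw [Finset.mul_sum]
    have := Finset.card_nsmul_le_sum T (fun u => lam * x u) (x v) h3
    rw [hT5] at this
    simpa using this
  have h5 : 5 * x v ≤ lam ^ 2 * x v := by
    have := mul_le_mul_of_nonneg_left h2 h0
    linarith [this, h4, show lam * (lam * x v) = lam ^ 2 * x v by ring]
  have h6 : 5 ≤ lam ^ 2 := le_of_mul_le_mul_right h5 (hx v)
  have h7 : lam ^ 2 < lambdaStar ^ 2 := pow_lt_pow_left₀ hlam h0 two_ne_zero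
  linarith [lambdaStar_sq_lt]

open Classical in
/-- The ball of radius `k` about `v`. -/
def ball (H : SimpleGraph V) (v : V) : ℕ → Finset V
  | 0 => {v}
  | k + 1 => ball H v k ∪ (ball H v k).biUnion fun w => {u | H.Adj w u}

theorem ball_mono (H : SimpleGraph V) (v : V) : Monotone (ball H v) :=
  monotone_nat_of_le_succ fun k => by classical exact Finset.subset_union_left

theorem mem_ball_self (H : SimpleGraph V) (v : V) (k : ℕ) : v ∈ ball H v k :=
  ball_mono H v (Nat.zero_le k) (by simp [ball])

theorem mem_ball_succ {H : SimpleGraph V} {v w u : V} {k : ℕ} (hw : w ∈ ball H v k)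
    (h : H.Adj w u) : u ∈ ball H v (k + 1) := by
  classical
  exact Finset.mem_union_right _ (Finset.mem_biUnion.2 ⟨w, hw, by simpa using h⟩)

theorem mem_ball_of_walk {H : SimpleGraph V} {q : ℕ → V} {n : ℕ}
    (h : ∀ k < n, H.Adj (q k) (q (k + 1))) {k : ℕ} (hk : k ≤ n) : q k ∈ ball H (q 0) k := by
  induction k with
  | zero => exact mem_ball_self H _ 0
  | succ k ih => exact mem_ball_succ (ih (by omega)) (h k (by omega))

theorem ball_connected (H : SimpleGraph V) (v : V) (k : ℕ) :
    (H.induce (ball H v k : Set V)).Connected := by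
  classical
  induction k with
  | zero => exact induce_singleton_connected H v
  | succ k ih =>
    have hsub : (ball H v k : Set V) ⊆ ball H v (k + 1) :=
      Finset.coe_subset.2 (ball_mono H v k.le_succ)
    have hr : ∀ w (hw : w ∈ ball H v k), (H.induce (ball H v (k + 1) : Set V)).Reachable
        ⟨v, mem_ball_self H v _⟩ ⟨w, hsub hw⟩ := fun w hw =>
      (ih.preconnected ⟨v, mem_ball_self H v _⟩ ⟨w, hw⟩).map (H.induceHomOfLE hsub).toHom
    rw [SimpleGraph.connected_iff_exists_forall_reachable]
    refine ⟨⟨v, mem_ball_self H v _⟩, ?_⟩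
    rintro ⟨u, hu⟩
    rcases Finset.mem_union.1 (Finset.mem_coe.1 hu) with hu' | hu'
    · exact hr u hu'
    · obtain ⟨w, hw, hwu⟩ := Finset.mem_biUnion.1 hu'
      have hwu' : H.Adj w u := by simpa using hwu
      exact (hr w hw).trans (SimpleGraph.Adj.reachable (by simpa using hwu'))

open Classical in
theorem card_ball_le {H : SimpleGraph V} (hdeg : ∀ v, #{u | H.Adj v u} ≤ 4) (v : V) (k : ℕ) :
    #(ball H v k) ≤ 5 ^ k := by
  induction k with
  | zero => simp [ball]
  | succ k ih =>
    calc #(ball H v (k + 1)) ≤ #(ball H v k) + #((ball H v k).biUnion fun w => {u | H.Adj w u}) :=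
          Finset.card_union_le _ _
      _ ≤ #(ball H v k) + #(ball H v k) * 4 := by
          gcongr
          exact Finset.card_biUnion_le_card_mul _ _ _ fun w _ => hdeg w
      _ ≤ 5 ^ (k + 1) := by rw [pow_succ]; omega

/-- Positive supersolutions exist on all balls of radius `R`. -/
def HasLocalSupersolutions (H : SimpleGraph V) (lam : ℝ) (R : ℕ) : Prop :=
  ∀ v, ∃ x : V → ℝ, (∀ w, 0 < x w) ∧ ∀ w ∈ ball H v R, nbSum H x w ≤ lam * x w

/-- The ball of radius `R + 1` contains all neighbours of the ball of radius `R`, so on the latter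
the induced inequality involves the full neighbour sum. -/
theorem IsLocallyBounded.hasLocalSupersolutions {H : SimpleGraph V} {lam : ℝ} {B R : ℕ}
    (h : IsLocallyBounded H lam B) (hB : 6 ≤ B) (hlam : lam < lambdaStar)
    (hR : 5 ^ (R + 1) ≤ B) : HasLocalSupersolutions H lam R := by
  classical
  intro v
  obtain ⟨x, hx, h1⟩ := h (ball H v (R + 1)) (ball_connected H v _)
    ((card_ball_le (fun v => by convert h.degree_le hB hlam v) v _).trans hR)
  refine ⟨x, hx, fun w hw => (le_of_eq ?_).trans (h1 w (ball_mono H v R.le_succ hw))⟩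
  refine Finset.sum_congr (Finset.ext fun u => ?_) fun _ _ => rfl
  simp only [mem_filter, mem_univ, true_and]
  exact ⟨fun hu => ⟨mem_ball_succ hw hu, hu⟩, fun hu => hu.2⟩

theorem IsLocallyBounded.exists_supersolution_of_card_le {H : SimpleGraph V} {lam : ℝ} {B : ℕ}
    (h : IsLocallyBounded H lam B) (hH : H.Connected) (hB : Fintype.card V ≤ B) :
    ∃ x : V → ℝ, (∀ v, 0 < x v) ∧ ∀ v, nbSum H x v ≤ lam * x v := by
  classical
  obtain ⟨x, hx, h1⟩ := h Finset.univ (by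
    rw [Finset.coe_univ]
    exact (SimpleGraph.induceUnivIso H).connected_iff.2 hH) hB
  exact ⟨x, hx, fun v => h1 v (Finset.mem_univ v)⟩

/-- `p 0, …, p L` is a path. -/
def IsPathSeq (H : SimpleGraph V) (p : ℕ → V) (L : ℕ) : Prop :=
  (∀ k < L, H.Adj (p k) (p (k + 1))) ∧ ∀ i ≤ L, ∀ j ≤ L, p i = p j → i = j

/-- `p 0, …, p L` is a path of maximum length. -/
def IsLongest (H : SimpleGraph V) (p : ℕ → V) (L : ℕ) : Prop :=
  IsPathSeq H p L ∧ ∀ q M, IsPathSeq H q M → M ≤ L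

theorem IsPathSeq.lt_card {H : SimpleGraph V} {p : ℕ → V} {L : ℕ} (h : IsPathSeq H p L) :
    L < Fintype.card V := by
  have h1 : Function.Injective fun i : Fin (L + 1) => p i := fun i j hij =>
    Fin.ext (h.2 i (by omega) j (by omega) hij)
  simpa using Fintype.card_le_of_injective _ h1

theorem IsPathSeq.reverse {H : SimpleGraph V} {p : ℕ → V} {L : ℕ} (h : IsPathSeq H p L) :
    IsPathSeq H (fun k => p (L - k)) L := by
  refine ⟨fun k hk => ?_, fun i hi j hj hij => ?_⟩
  · have := h.1 (L - (k + 1)) (by omega)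
    rw [show L - (k + 1) + 1 = L - k by omega] at this
    exact this.symm
  · have := h.2 (L - i) (by omega) (L - j) (by omega) hij
    omega

theorem IsLongest.reverse {H : SimpleGraph V} {p : ℕ → V} {L : ℕ} (h : IsLongest H p L) :
    IsLongest H (fun k => p (L - k)) L := ⟨h.1.reverse, h.2⟩

/-- Prepend a vertex to a sequence. -/
def consSeq (u : V) (p : ℕ → V) : ℕ → V
  | 0 => u
  | k + 1 => p k

theorem IsPathSeq.cons {H : SimpleGraph V} {p : ℕ → V} {L : ℕ} (h : IsPathSeq H p L) {u : V}
    (hu : H.Adj u (p 0)) (hne : ∀ j ≤ L, u ≠ p j) : IsPathSeq H (consSeq u p) (L + 1) := by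
  refine ⟨?_, ?_⟩
  · rintro (_ | k) hk
    · exact hu
    · exact h.1 k (by omega)
  · rintro (_ | i) hi (_ | j) hj hij
    · rfl
    · exact absurd hij (hne j (by omega))
    · exact absurd hij.symm (hne i (by omega))
    · rw [h.2 i (by omega) j (by omega) hij]

theorem IsPathSeq.tail {H : SimpleGraph V} {p : ℕ → V} {L : ℕ} (h : IsPathSeq H p (L + 1)) :
    IsPathSeq H (fun k => p (k + 1)) L :=
  ⟨fun k hk => h.1 (k + 1) (by omega), fun i hi j hj hij => by
    have := h.2 (i + 1) (by omega) (j + 1) (by omega) hij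
    omega⟩

theorem IsLongest.mem_of_adj_zero {H : SimpleGraph V} {p : ℕ → V} {L : ℕ} (h : IsLongest H p L)
    {u : V} (hu : H.Adj (p 0) u) : ∃ j ≤ L, u = p j := by
  by_contra! hne
  have := h.2 _ _ (h.1.cons hu.symm hne)
  omega

theorem exists_isLongest [Nonempty V] (H : SimpleGraph V) : ∃ p L, IsLongest H p L := by
  obtain ⟨v⟩ := ‹Nonempty V›
  let S : Set ℕ := {L | ∃ p, IsPathSeq H p L}
  have hne : S.Nonempty := ⟨0, fun _ => v, fun k hk => absurd hk (by omega), fun i hi j hj _ => by omega⟩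
  have hb : BddAbove S := ⟨Fintype.card V, fun L ⟨p, hp⟩ => hp.lt_card.le⟩
  obtain ⟨p, hp⟩ := Nat.sSup_mem hne hb
  exact ⟨p, sSup S, hp, fun q M hq => le_csSup hb ⟨q, hq⟩⟩

-- Every vertex is reached from `p 0` by a path, hence within distance `L`.
open Classical in
theorem IsLongest.card_le {H : SimpleGraph V} {p : ℕ → V} {L : ℕ} (h : IsLongest H p L)
    (hH : H.Connected) (hdeg : ∀ v, #{u | H.Adj v u} ≤ 4) : Fintype.card V ≤ 5 ^ L := by
  have : (Finset.univ : Finset V) ⊆ ball H (p 0) L := by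
    intro w _
    obtain ⟨P, hP⟩ := (hH.preconnected (p 0) w).exists_isPath
    have hseq : IsPathSeq H P.getVert P.length :=
      ⟨fun k hk => P.adj_getVert_succ hk, fun i hi j hj hij => hP.getVert_injOn hi hj hij⟩
    have h1 := mem_ball_of_walk hseq.1 le_rfl
    rw [P.getVert_zero, P.getVert_length] at h1
    exact ball_mono H _ (h.2 _ _ hseq) h1
  calc Fintype.card V = #(Finset.univ : Finset V) := rfl
    _ ≤ _ := (Finset.card_le_card this).trans (card_ball_le hdeg _ _)

end Local

/-! ### The range `lam < 2`. -/

section BelowTwo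
variable {V : Type*} [Fintype V]

/-- Below `2`, long paths are excluded. -/
theorem HasLocalSupersolutions.lt_of_isPathSeq {H : SimpleGraph V} {lam : ℝ} (hlam : lam < 2)
    {R : ℕ} (hR : lam ≤ R * (2 - lam)) (h : HasLocalSupersolutions H lam R) {p : ℕ → V} {L : ℕ}
    (hp : IsPathSeq H p L) : L ≤ R := by
  by_contra! hL
  obtain ⟨x, hx, h1⟩ := h (p 0)
  -- Since `a + 1/a ≥ 2`, each step lowers the bound on the ratio of consecutive values by `2 -
  -- lam`; after `R` steps it is nonpositive.
  have key : ∀ k ≤ R, x (p (k + 1)) ≤ (lam - k * (2 - lam)) * x (p k) := by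
    intro k hk
    induction k with
    | zero =>
      have h2 := le_nbSum_of_adj H (fun v => (hx v).le) (hp.1 0 (by omega))
      simpa using h2.trans (h1 (p 0) (mem_ball_self H _ _))
    | succ k ih =>
      have h2 := ih (by omega)
      have h3 := add_le_nbSum H hx (hp.1 k (by omega)).symm (hp.1 (k + 1) (by omega))
        (fun he => by have := hp.2 k (by omega) (k + 2) (by omega) he; omega)
      have h4 := h3.trans (h1 _ (ball_mono H _ hk (mem_ball_of_walk hp.1 (k := k + 1) (by omega))))
      set a := lam - k * (2 - lam) with ha
      have h5 : (2 - a) * x (p (k + 1)) ≤ x (p k) := by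
        have h0 := hx (p k)
        have ha0 : 0 < a := pos_of_mul_pos_left ((hx (p (k + 1))).trans_le h2) h0.le
        rcases le_total 2 a with h6 | h6
        · nlinarith [hx (p (k + 1))]
        · have h7 := mul_le_mul_of_nonneg_left h2 (sub_nonneg.2 h6)
          nlinarith [sq_nonneg (a - 1)]
      push_cast
      have h6 : lam - (k + 1) * (2 - lam) = a - (2 - lam) := by rw [ha]; ring
      rw [h6]
      linarith
  have h2 := key R le_rfl
  have h3 := hx (p (R + 1))
  have h4 := hx (p R)
  nlinarith

theorem exists_bound_of_lt_two {lam : ℝ} (hlam : lam < 2) : ∃ B : ℕ, ∀ {V : Type} [Fintype V]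
    (H : SimpleGraph V), H.Connected → IsLocallyBounded H lam B →
      ∃ x : V → ℝ, (∀ v, 0 < x v) ∧ ∀ v, nbSum H x v ≤ lam * x v := by
  obtain ⟨R, hR⟩ := exists_nat_ge (lam / (2 - lam))
  rw [div_le_iff₀ (by linarith)] at hR
  refine ⟨5 ^ (R + 2), fun {V} _ H hH h => ?_⟩
  have hB : 6 ≤ 5 ^ (R + 2) := by
    have : 1 ≤ 5 ^ R := Nat.one_le_pow _ _ (by norm_num)
    rw [pow_add]; omega
  have hls : lam < lambdaStar := hlam.trans_le two_le_lambdaStar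
  have := hH.nonempty
  obtain ⟨p, L, hp⟩ := exists_isLongest H
  have hL := (h.hasLocalSupersolutions hB hls (R := R)
    (Nat.pow_le_pow_right (by norm_num) (by omega))).lt_of_isPathSeq hlam hR hp.1
  refine h.exists_supersolution_of_card_le hH ((hp.card_le hH (h.degree_le hB hls)).trans ?_)
  exact Nat.pow_le_pow_right (by norm_num) (by omega)

end BelowTwo

/-! ### From local bounds to finite forbidden families. -/

/-- The connected graphs on at most `B` vertices of spectral radius greater than `lam`. -/
def smallForbidden (lam : ℝ) (B : ℕ) : Set FinGraph :=
  {G | G.order ≤ B ∧ G.graph.Connected ∧ lam < spectralRadius G.graph}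

theorem finite_smallForbidden (lam : ℝ) (B : ℕ) : (smallForbidden lam B).Finite := by
  let f : (Σ n : Fin (B + 1), SimpleGraph (Fin n)) → FinGraph := fun a => ⟨a.1, a.2⟩
  refine (Set.finite_range f).subset ?_
  rintro ⟨n, G⟩ ⟨hn, -⟩
  exact ⟨⟨⟨n, Nat.lt_succ_of_le hn⟩, G⟩, rfl⟩

/-- A small connected induced subgraph of radius above `lam` would be a forbidden graph up to
isomorphism. Otherwise its Perron vector is the certificate; the value `1` off `S` is arbitrary. -/
theorem isLocallyBounded_of_mem_connectedAvoiding {lam : ℝ} {B : ℕ} {H : FinGraph}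
    (h : H ∈ connectedAvoiding (smallForbidden lam B)) : IsLocallyBounded H.graph lam B := by
  classical
  intro S hS hSB
  have hne : Nonempty (S : Set (Fin H.order)) := hS.nonempty
  have hle : spectralRadius (H.graph.induce (S : Set (Fin H.order))) ≤ lam := by
    by_contra! hlt
    obtain ⟨G, hG, ⟨e⟩⟩ := exists_finGraph_iso (H.graph.induce (S : Set (Fin H.order)))
    have : Nonempty (Fin G.order) := ⟨e hne.some⟩
    refine h.2 G ⟨?_, e.connected_iff.1 hS, ?_⟩ ?_
    · rw [hG]; simpa using hSB
    · rwa [← spectralRadius_congr e]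
    · exact ⟨(SimpleGraph.Embedding.induce (S : Set (Fin H.order))).toCopy.comp e.symm.toCopy⟩
  obtain ⟨y, hy, hy1⟩ := exists_eigenvector_pos hS
  refine ⟨fun v => if hv : v ∈ S then y ⟨v, hv⟩ else 1, fun v => ?_, fun w hw => ?_⟩
  · simp only
    split_ifs
    · exact hy _
    · exact one_pos
  · simp only [hw, dif_pos]
    have h1 : nbSum (H.graph.induce (S : Set (Fin H.order))) y ⟨w, hw⟩ ≤ lam * y ⟨w, hw⟩ := by
      rw [hy1]; exact mul_le_mul_of_nonneg_right hle (hy _).le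
    refine le_trans (le_of_eq ?_) h1
    rw [Finset.sum_filter, nbSum, Finset.sum_filter, ← Finset.sum_coe_sort S]
    refine Finset.sum_congr rfl fun u _ => ?_
    simp

/-- A local certificate for the spectral radius gives a finite list of forbidden subgraphs. -/
theorem exists_finite_forbidden {lam : ℝ} (h : ∃ B : ℕ, ∀ {V : Type} [Fintype V]
    (H : SimpleGraph V), H.Connected → IsLocallyBounded H lam B →
      ∃ x : V → ℝ, (∀ v, 0 < x v) ∧ ∀ v, nbSum H x v ≤ lam * x v) :
    ∃ 𝒢 : Set FinGraph, 𝒢.Finite ∧ (∀ G ∈ 𝒢, G.graph.Connected) ∧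
      family lam = connectedAvoiding 𝒢 := by
  obtain ⟨B, hB⟩ := h
  refine ⟨smallForbidden lam B, finite_smallForbidden lam B, fun G hG => hG.2.1, ?_⟩
  ext H
  refine ⟨fun hH => ⟨hH.1, fun G hG hGH => ?_⟩, fun hH => ⟨hH.1, ?_⟩⟩
  · have := hG.2.1.nonempty
    linarith [spectralRadius_mono hGH, hG.2.2, hH.2]
  · have := hH.1.nonempty
    obtain ⟨x, hx, hx1⟩ := hB H.graph hH.1 (isLocallyBounded_of_mem_connectedAvoiding hH)
    exact spectralRadius_le H.graph hx hx1

/-! ### Structure of graphs with long paths for `2 ≤ lam < λ*`. -/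

section Structure
variable {V : Type*} [Fintype V] {H : SimpleGraph V} {t lam : ℝ}

/-- `q 0, …, q n` is a walk without backtracking. -/
def IsNonbacktracking (H : SimpleGraph V) (q : ℕ → V) (n : ℕ) : Prop :=
  (∀ k < n, H.Adj (q k) (q (k + 1))) ∧ ∀ k, k + 2 ≤ n → q k ≠ q (k + 2)

theorem IsNonbacktracking.tail {q : ℕ → V} {n : ℕ} (h : IsNonbacktracking H q (n + 1)) :
    IsNonbacktracking H (fun k => q (k + 1)) n :=
  ⟨fun k hk => h.1 (k + 1) (by omega), fun k hk => h.2 (k + 1) (by omega)⟩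

theorem isNonbacktracking_one {v c : V} (h : H.Adj v c) :
    IsNonbacktracking H (consSeq v fun _ => c) 1 := by
  refine ⟨fun k hk => ?_, fun k hk => by omega⟩
  obtain rfl : k = 0 := by omega
  exact h

theorem isNonbacktracking_two {v c e : V} (h : H.Adj v c) (h' : H.Adj c e) (hne : e ≠ v) :
    IsNonbacktracking H (consSeq v (consSeq c fun _ => e)) 2 := by
  refine ⟨fun k hk => ?_, fun k hk => ?_⟩
  · obtain rfl | rfl : k = 0 ∨ k = 1 := by omega
    · exact h
    · exact h'
  · obtain rfl : k = 0 := by omega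
    exact hne.symm

theorem IsPathSeq.forward {p : ℕ → V} {L : ℕ} (hp : IsPathSeq H p L) {i n : ℕ}
    (h : i + n ≤ L) : IsNonbacktracking H (fun k => p (i + k)) n :=
  ⟨fun k hk => hp.1 (i + k) (by omega), fun k hk he => by
    have := hp.2 (i + k) (by omega) (i + (k + 2)) (by omega) he
    omega⟩

theorem IsPathSeq.backward {p : ℕ → V} {L : ℕ} (hp : IsPathSeq H p L) {i n : ℕ}
    (hi : i ≤ L) (h : n ≤ i) : IsNonbacktracking H (fun k => p (i - k)) n :=
  ⟨fun k hk => by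
    have := (hp.1 (i - (k + 1)) (by omega)).symm
    rwa [show i - (k + 1) + 1 = i - k by omega] at this, fun k hk he => by
    have := hp.2 (i - k) (by omega) (i - (k + 2)) (by omega) he
    omega⟩

/-- The continued fraction is built from the far end of the walk and uses only that the two walk
neighbours of each interior vertex differ. Thus the walk may revisit vertices, for instance by
winding around a cycle. -/
theorem pathRatio_mul_le (ht : 1 ≤ t) (hlam : lam = t + 1 / t) {x : V → ℝ} (hx : ∀ v, 0 < x v)
    {n : ℕ} : ∀ {q : ℕ → V}, IsNonbacktracking H q n →
    (∀ k, 1 ≤ k → k ≤ n → nbSum H x (q k) ≤ lam * x (q k)) →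
    pathRatio lam n * x (q 0) ≤ x (q 1) := by
  induction n with
  | zero => intro q _ _; simpa [pathRatio] using (hx (q 1)).le
  | succ n ih =>
    intro q hq hs
    have h0 := lt_sub_pathRatio ht hlam n
    have h1 := hs 1 le_rfl (by omega)
    have h2 : x (q 0) + pathRatio lam n * x (q 1) ≤ nbSum H x (q 1) := by
      rcases Nat.eq_zero_or_pos n with rfl | hn
      · simpa [pathRatio] using
          le_nbSum_of_adj H (fun v => (hx v).le) (hq.1 0 (by omega)).symm
      · have h3 := ih hq.tail fun k hk hk' => hs (k + 1) (by omega) (by omega)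
        have h4 := add_le_nbSum H hx (hq.1 0 (by omega)).symm (hq.1 1 (by omega))
          (hq.2 0 (by omega))
        exact le_trans (by linarith [show pathRatio lam n * x (q 1) ≤ x (q 2) from h3]) h4
    simp only [pathRatio]
    rw [one_div_mul_eq_div, div_le_iff₀ (by linarith)]
    linarith

theorem IsNonbacktracking.mul_le {x : V → ℝ} {q : ℕ → V} {n R : ℕ} (ht : 1 ≤ t)
    (hlam : lam = t + 1 / t) (hx : ∀ v, 0 < x v) {v : V}
    (hs : ∀ w ∈ ball H v R, nbSum H x w ≤ lam * x w) (hq : IsNonbacktracking H q n)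
    (hv : q 0 = v) (hn : n ≤ R) : pathRatio lam n * x v ≤ x (q 1) := by
  subst hv
  exact pathRatio_mul_le ht hlam hx hq fun k _ hk =>
    hs _ (ball_mono H _ (hk.trans hn) (mem_ball_of_walk hq.1 hk))

/-- The legs may overlap: only their first vertices must be distinct. -/
theorem HasLocalSupersolutions.spider {R : ℕ} (h : HasLocalSupersolutions H lam R) (ht : 1 ≤ t)
    (hlam : lam = t + 1 / t) {v : V} {q₁ q₂ q₃ : ℕ → V} {a b c : ℕ}
    (h₁ : IsNonbacktracking H q₁ a) (h₂ : IsNonbacktracking H q₂ b)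
    (h₃ : IsNonbacktracking H q₃ c) (v₁ : q₁ 0 = v) (v₂ : q₂ 0 = v) (v₃ : q₃ 0 = v)
    (n₁ : q₁ 1 ≠ q₂ 1) (n₂ : q₁ 1 ≠ q₃ 1) (n₃ : q₂ 1 ≠ q₃ 1) (ha : 1 ≤ a ∧ a ≤ R)
    (hb : 1 ≤ b ∧ b ≤ R) (hc : 1 ≤ c ∧ c ≤ R) :
    pathRatio lam a + pathRatio lam b + pathRatio lam c ≤ lam := by
  obtain ⟨x, hx, hs⟩ := h v
  have e₁ := h₁.mul_le ht hlam hx hs v₁ ha.2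
  have e₂ := h₂.mul_le ht hlam hx hs v₂ hb.2
  have e₃ := h₃.mul_le ht hlam hx hs v₃ hc.2
  have a₁ := h₁.1 0 ha.1
  have a₂ := h₂.1 0 hb.1
  have a₃ := h₃.1 0 hc.1
  rw [v₁] at a₁
  rw [v₂] at a₂
  rw [v₃] at a₃
  have h4 := (add_add_le_nbSum H hx a₁ a₂ a₃ n₁ n₂ n₃).trans (hs v (mem_ball_self H v R))
  simp only [zero_add] at h4
  exact le_of_mul_le_mul_right (by linarith) (hx v)

theorem HasLocalSupersolutions.four_branches {R : ℕ} (h : HasLocalSupersolutions H lam R)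
    (ht : 1 ≤ t) (hlam : lam = t + 1 / t) (hR : 2 ≤ R) {v a b c d e : V} (ha : H.Adj v a)
    (hb : H.Adj v b) (hc : H.Adj v c) (hd : H.Adj v d) (hab : a ≠ b) (hac : a ≠ c)
    (had : a ≠ d) (hbc : b ≠ c) (hbd : b ≠ d) (hcd : c ≠ d) (he : H.Adj a e) (hev : e ≠ v) :
    pathRatio lam 2 + 3 * pathRatio lam 1 ≤ lam := by
  obtain ⟨x, hx, hs⟩ := h v
  have e₁ := (isNonbacktracking_two ha he hev).mul_le ht hlam hx hs rfl hR
  have e₂ := (isNonbacktracking_one hb).mul_le ht hlam hx hs rfl (by omega)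
  have e₃ := (isNonbacktracking_one hc).mul_le ht hlam hx hs rfl (by omega)
  have e₄ := (isNonbacktracking_one hd).mul_le ht hlam hx hs rfl (by omega)
  simp only [consSeq] at e₁ e₂ e₃ e₄
  have h4 := (add_add_add_le_nbSum H hx ha hb hc hd hab hac had hbc hbd hcd).trans
    (hs v (mem_ball_self H v R))
  exact le_of_mul_le_mul_right (by linarith) (hx v)

/-- The numerical conditions under which small trees of spectral radius greater than `lam` control
the structure of a graph. -/
structure Thresholds (t lam : ℝ) (n M : ℕ) : Prop where
  one_le : 1 ≤ t
  lam_eq : lam = t + 1 / t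
  two_le : 2 ≤ n
  le : n ≤ M
  spider_one : lam < pathRatio lam 1 + 2 * pathRatio lam n
  spider_two : lam < 2 * pathRatio lam 2 + pathRatio lam n
  four : lam < pathRatio lam 2 + 3 * pathRatio lam 1
  long : ∀ i < n, lam < pathRatio lam i + pathRatio lam 1 + 1 / t →
    lam < pathRatio lam i + pathRatio lam 1 + pathRatio lam M

theorem pathRatio_one (lam : ℝ) : pathRatio lam 1 = 1 / lam := by simp [pathRatio]

/-- With infinite legs, `spider_one` and `spider_two` both reduce to `x² < x + 1` for `x = t²`, and
strict inequalities survive truncation. The field `long` is finitely many conditions, so one `M`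
serves all. -/
theorem exists_thresholds (ht : 1 ≤ t) (hlam : lam = t + 1 / t) (h : lam < lambdaStar) :
    ∃ n M, Thresholds t lam n M := by
  have ht0 : 0 < t := by linarith
  have hlam0 : 0 < lam := by rw [hlam]; positivity
  have hx := sq_lt_add_one_of_lt_lambdaStar ht (hlam ▸ h)
  have hmono := pathRatio_mono ht hlam
  have h1 : lam < 1 / lam + 2 * (1 / t) := by
    have : 1 / lam + 2 * (1 / t) - lam = (t ^ 2 + 1 - (t ^ 2) ^ 2) / (t * (t ^ 2 + 1)) := by
      rw [hlam]; field_simp; ring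
    have : 0 < (t ^ 2 + 1 - (t ^ 2) ^ 2) / (t * (t ^ 2 + 1)) := div_pos (by linarith) (by positivity)
    linarith
  have h2 : lam < 2 * pathRatio lam 2 + 1 / t := by
    have h3 : pathRatio lam 2 = 1 / (lam - 1 / lam) := by simp [pathRatio]
    have h4 : 2 * (1 / (lam - 1 / lam)) + 1 / t - lam =
        t * (t ^ 2 + 1 - (t ^ 2) ^ 2) / ((t ^ 2) ^ 2 + t ^ 2 + 1) := by
      have : lam - 1 / lam = ((t ^ 2) ^ 2 + t ^ 2 + 1) / (t * (t ^ 2 + 1)) := by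
        rw [hlam]; field_simp; ring
      rw [this, hlam]; field_simp; ring
    have : 0 < t * (t ^ 2 + 1 - (t ^ 2) ^ 2) / ((t ^ 2) ^ 2 + t ^ 2 + 1) :=
      div_pos (mul_pos ht0 (by linarith)) (by positivity)
    rw [h3]; linarith
  obtain ⟨n₁, hn₁⟩ := exists_lt_pathRatio ht hlam (b := (lam - 1 / lam) / 2) (by linarith)
  obtain ⟨n₂, hn₂⟩ := exists_lt_pathRatio ht hlam (b := lam - 2 * pathRatio lam 2) (by linarith)
  set n := n₁ + n₂ + 2 with hn
  have hi : ∀ i, ∃ m, lam < pathRatio lam i + pathRatio lam 1 + 1 / t →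
      lam < pathRatio lam i + pathRatio lam 1 + pathRatio lam m := by
    intro i
    by_cases hc : lam < pathRatio lam i + pathRatio lam 1 + 1 / t
    · obtain ⟨m, hm⟩ := exists_lt_pathRatio ht hlam
        (b := lam - pathRatio lam i - pathRatio lam 1) (by linarith)
      exact ⟨m, fun _ => by linarith⟩
    · exact ⟨0, fun hc' => absurd hc' hc⟩
  choose m hm using hi
  refine ⟨n, n + (range n).sup m, ht, hlam, by omega, by omega, ?_, ?_, ?_, fun i hin hlt => ?_⟩
  · have := hmono (show n₁ ≤ n by omega)
    rw [pathRatio_one]; linarith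
  · have := hmono (show n₂ ≤ n by omega)
    linarith
  · have h5 : lam ^ 2 < 4.24 := (pow_lt_pow_left₀ h hlam0.le two_ne_zero).trans lambdaStar_sq_lt
    have h6 : 4 ≤ lam ^ 2 := by
      have : lam ^ 2 = (t - 1 / t) ^ 2 + 4 := by rw [hlam]; field_simp; ring
      nlinarith [sq_nonneg (t - 1 / t)]
    have h3 : pathRatio lam 2 = 1 / (lam - 1 / lam) := by simp [pathRatio]
    have h8 : 0 < lam ^ 2 - 1 := by linarith
    have h9 : 1 / (lam - 1 / lam) = lam / (lam ^ 2 - 1) := by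
      have : lam - 1 / lam = (lam ^ 2 - 1) / lam := by field_simp
      rw [this, one_div_div]
    have h7 : pathRatio lam 2 + 3 * pathRatio lam 1 - lam =
        (5 * lam ^ 2 - 3 - (lam ^ 2) ^ 2) / (lam * (lam ^ 2 - 1)) := by
      rw [h3, h9, pathRatio_one]; field_simp; ring
    -- In `lam²` the numerator has larger root `(5 + √13) / 2 ≈ 4.30`, beyond the range `4 ≤ lam² <
    -- 4.24`.
    have : 0 < (5 * lam ^ 2 - 3 - (lam ^ 2) ^ 2) / (lam * (lam ^ 2 - 1)) :=
      div_pos (by nlinarith) (by positivity)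
    linarith
  · refine (hm i hlt).trans_le ?_
    have : m i ≤ n + (range n).sup m :=
      (Finset.le_sup (f := m) (Finset.mem_range.2 hin)).trans (Nat.le_add_left _ _)
    linarith [hmono this]

variable {n M : ℕ}

theorem Thresholds.middle (T : Thresholds t lam n M) (h : HasLocalSupersolutions H lam (M + 2))
    {p : ℕ → V} {L : ℕ} (hp : IsPathSeq H p L) {i : ℕ} (hi : n ≤ i) (hi' : i + n ≤ L) {u : V}
    (hu : H.Adj (p i) u) : u = p (i - 1) ∨ u = p (i + 1) := by
  have h2 := T.two_le
  have hM := T.le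
  by_contra! hne
  have := h.spider T.one_le T.lam_eq (isNonbacktracking_one hu)
    (hp.backward (i := i) (n := n) (by omega) hi) (hp.forward hi') rfl rfl rfl hne.1 hne.2
    (fun he => by have := hp.2 (i - 1) (by omega) (i + 1) (by omega) he; omega)
    (by omega) (by omega) (by omega)
  linarith [T.spider_one]

/-- Indexing by `ZMod N` lets both legs wind around the cycle, so even a short cycle provides legs
of length `n`. -/
theorem Thresholds.cycle (T : Thresholds t lam n M) (h : HasLocalSupersolutions H lam (M + 2))
    {N : ℕ} (hN : 3 ≤ N) {z : ZMod N → V} (hz : Function.Injective z)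
    (hadj : ∀ i, H.Adj (z i) (z (i + 1))) (i : ZMod N) {u : V} (hu : H.Adj (z i) u) :
    u = z (i - 1) ∨ u = z (i + 1) := by
  have h2 := T.two_le
  have hM := T.le
  have h20 : (2 : ZMod N) ≠ 0 := by
    intro h0
    have : ((2 : ℕ) : ZMod N) = 0 := by exact_mod_cast h0
    rw [ZMod.natCast_eq_zero_iff] at this
    exact absurd (Nat.le_of_dvd (by norm_num) this) (by omega)
  by_contra! hne
  have hf : IsNonbacktracking H (fun k : ℕ => z (i + k)) n := by
    refine ⟨fun k _ => ?_, fun k _ he => h20 ?_⟩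
    · have := hadj (i + k)
      push_cast; rwa [← add_assoc]
    · have := hz he
      push_cast at this
      linear_combination -this
  have hb : IsNonbacktracking H (fun k : ℕ => z (i - k)) n := by
    refine ⟨fun k _ => ?_, fun k _ he => h20 ?_⟩
    · have := (hadj (i - (k + 1 : ℕ))).symm
      rwa [show i - ((k + 1 : ℕ) : ZMod N) + 1 = i - k by push_cast; ring] at this
    · have := hz he
      push_cast at this
      linear_combination this
  have := h.spider T.one_le T.lam_eq (isNonbacktracking_one hu) hb hf rfl
    (by simp [consSeq]) (by simp [consSeq])
    (by simpa [consSeq] using hne.1) (by simpa [consSeq] using hne.2)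
    (fun he => h20 (by
      have := hz he
      push_cast at this
      linear_combination -this))
    (by omega) (by omega) (by omega)
  linarith [T.spider_one]

theorem nbSum_le_of_subset {x : V → ℝ} (hx : ∀ v, 0 ≤ x v) {v : V} [DecidableEq V] {s : Finset V}
    (h : ∀ u, H.Adj v u → u ∈ s) : nbSum H x v ≤ ∑ u ∈ s, x u := by
  classical
  exact Finset.sum_le_sum_of_subset_of_nonneg (fun u hu => h u (by simpa using hu))
    fun u _ _ => hx u

theorem nbSum_le_of_two {x : V → ℝ} (hx : ∀ v, 0 ≤ x v) {v a b : V}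
    (h : ∀ u, H.Adj v u → u = a ∨ u = b) : nbSum H x v ≤ x a + x b := by
  classical
  by_cases hab : a = b
  · subst hab
    have := nbSum_le_of_subset (s := {a}) hx fun u hu => by simpa using h u hu
    rw [Finset.sum_singleton] at this
    linarith [hx a]
  · rw [← Finset.sum_pair hab]
    exact nbSum_le_of_subset hx fun u hu => by simpa using h u hu

theorem mem_of_connected_of_closed (hH : H.Connected) {P : V → Prop} {v : V} (hv : P v)
    (hP : ∀ a b, H.Adj a b → P a → P b) (w : V) : P w := by
  obtain ⟨q⟩ := hH.preconnected v w
  induction q with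
  | nil => exact hv
  | cons hab _ ih => exact ih (hP _ _ hab hv)

/-- A connected graph with a longest path that has a chord is a cycle. -/
theorem Thresholds.supersolution_of_chord (T : Thresholds t lam n M)
    (h : HasLocalSupersolutions H lam (M + 2)) (hH : H.Connected) {p : ℕ → V} {L : ℕ}
    (hp : IsPathSeq H p L) {a b : ℕ} (hab : a + 2 ≤ b) (hb : b ≤ L) (hadj : H.Adj (p a) (p b)) :
    ∃ x : V → ℝ, (∀ v, 0 < x v) ∧ ∀ v, nbSum H x v ≤ lam * x v := by
  have ht := T.one_le
  set N := b - a + 1 with hN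
  have : NeZero N := ⟨by omega⟩
  have : Fact (1 < N) := ⟨by omega⟩
  set z : ZMod N → V := fun i => p (a + i.val) with hzdef
  have hlt : ∀ i : ZMod N, i.val < N := fun i => ZMod.val_lt i
  have hz : Function.Injective z := fun i j hij => by
    have := hp.2 (a + i.val) (by have := hlt i; omega) (a + j.val) (by have := hlt j; omega) hij
    exact ZMod.val_injective N (by omega)
  have hzadj : ∀ i, H.Adj (z i) (z (i + 1)) := by
    intro i
    have hi := hlt i
    simp only [hzdef]
    rw [ZMod.val_add, ZMod.val_one]
    rcases Nat.lt_or_ge (i.val + 1) N with h1 | h1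
    · rw [Nat.mod_eq_of_lt h1]
      exact hp.1 (a + i.val) (by omega)
    · have h3 : i.val + 1 = N := by omega
      rw [h3, Nat.mod_self, show a + i.val = b by omega]
      exact hadj.symm
  have hcyc := T.cycle h (N := N) (by omega) hz hzadj
  have hall := mem_of_connected_of_closed hH (P := fun v => ∃ i, v = z i) ⟨0, rfl⟩ (by
    rintro _ v hav ⟨i, rfl⟩
    rcases hcyc i hav with rfl | rfl
    · exact ⟨_, rfl⟩
    · exact ⟨_, rfl⟩)
  -- All degrees are at most two and `lam ≥ 2`, so the constant vector works.
  refine ⟨fun _ => 1, fun _ => one_pos, fun v => ?_⟩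
  obtain ⟨i, rfl⟩ := hall v
  have h1 := nbSum_le_of_two (x := fun _ => 1) (fun _ => one_pos.le) fun u hu => hcyc i hu
  have h2 : 2 ≤ lam := by
    have : t + 1 / t - 2 = (t - 1) ^ 2 / t := by field_simp; ring
    have : 0 ≤ (t - 1) ^ 2 / t := by positivity
    linarith [T.lam_eq]
  linarith

/-- Two branch vertices near the same end of a long path are impossible. -/
theorem Thresholds.no_fork (T : Thresholds t lam n M) (h : HasLocalSupersolutions H lam (M + 2))
    {p : ℕ → V} {L : ℕ} (hp : IsPathSeq H p L) {i j : ℕ} (hj : 1 ≤ j) (hji : j < i) (hi : i < n)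
    (hL : 2 * n ≤ L) {c d : V} (hc : H.Adj (p i) c) (hc₁ : c ≠ p (i - 1)) (hc₂ : c ≠ p (i + 1))
    (hd : H.Adj (p j) d) (hd₁ : d ≠ p (j - 1)) (hd₂ : d ≠ p (j + 1)) : False := by
  have ht := T.one_le
  have ht0 : 0 < t := by linarith
  have hM := T.le
  have hlam0 : 0 < lam := by rw [T.lam_eq]; positivity
  obtain ⟨x, hx, hs⟩ := h (p i)
  have hball : ∀ k ≤ i, p k ∈ ball H (p i) (i - k) := by
    intro k hk
    have := mem_ball_of_walk (hp.backward (i := i) (n := i) (by omega) le_rfl).1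
      (k := i - k) (by omega)
    simp only [Nat.sub_zero] at this
    rwa [show i - (i - k) = k by omega] at this
  have hsp : ∀ k ≤ i, nbSum H x (p k) ≤ lam * x (p k) := fun k hk =>
    hs _ (ball_mono H _ (by omega) (hball k hk))
  have hadj' : ∀ k < i, H.Adj (p (k + 1)) (p k) := fun k hk => (hp.1 k (by omega)).symm
  have hne : ∀ k ≤ i, 1 ≤ k → p (k - 1) ≠ p (k + 1) := fun k hk hk1 he => by
    have := hp.2 (k - 1) (by omega) (k + 1) (by omega) he; omega
  have hprev : ∀ k ≤ i, 1 ≤ k → H.Adj (p k) (p (k - 1)) := fun k hk hk1 => by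
    have := hadj' (k - 1) (by omega)
    rwa [Nat.sub_add_cancel hk1] at this
  -- The two side neighbours at `p j` give ratio at most `lam - 2 / lam ≤ t`, and the bound `t`
  -- propagates. Seen from `p i`, the side towards `p j` thus weighs as much as an infinite leg.
  have key : ∀ k, j ≤ k → k < i → x (p (k + 1)) ≤ t * x (p k) := by
    intro k hjk
    induction k, hjk using Nat.le_induction with
    | base =>
      intro hki
      have h1 := (add_add_le_nbSum H hx (hprev j hji.le hj) hd (hp.1 j (by omega)) hd₁.symm
        (hne j hji.le hj) hd₂).trans (hsp j hji.le)
      have h2 := (le_nbSum_of_adj H (fun v => (hx v).le) (hprev j hji.le hj).symm).trans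
        (hsp (j - 1) (by omega))
      have h3 := (le_nbSum_of_adj H (fun v => (hx v).le) hd.symm).trans
        (hs d (ball_mono H _ (by omega) (mem_ball_succ (hball j hji.le) hd)))
      have h4 : lam * x (p (j + 1)) ≤ (lam ^ 2 - 2) * x (p j) := by nlinarith
      have h5 : lam ^ 2 - 2 ≤ lam * t := by
        have h6 : lam * t - (lam ^ 2 - 2) = 1 - (1 / t) ^ 2 := by
          rw [T.lam_eq]; field_simp; ring
        have h7 : (1 / t) ^ 2 ≤ 1 := by
          rw [div_pow, one_pow, div_le_one (by positivity)]; nlinarith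
        linarith
      have h6 := mul_le_mul_of_nonneg_right h5 (hx (p j)).le
      exact le_of_mul_le_mul_left (by linarith) hlam0
    | succ k hjk ih =>
      intro hki
      have h1 := ih (by omega)
      have h2 := (add_le_nbSum H hx (hadj' k (by omega)) (hp.1 (k + 1) (by omega))
        (hne (k + 1) (by omega) (by omega))).trans (hsp (k + 1) (by omega))
      have h3 : 1 / t * x (p (k + 1)) ≤ x (p k) := by
        rw [one_div_mul_eq_div, div_le_iff₀ ht0]; linarith
      have h4 : lam * x (p (k + 1)) = t * x (p (k + 1)) + 1 / t * x (p (k + 1)) := by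
        rw [T.lam_eq]; ring
      linarith
  have h1 := key (i - 1) (by omega) (by omega)
  rw [Nat.sub_add_cancel (by omega)] at h1
  have h2 : 1 / t * x (p i) ≤ x (p (i - 1)) := by
    rw [one_div_mul_eq_div, div_le_iff₀ ht0]; linarith
  have h3 := (hp.forward (i := i) (n := n) (by omega)).mul_le ht T.lam_eq hx hs rfl (by omega)
  have h4 := (isNonbacktracking_one hc).mul_le ht T.lam_eq hx hs rfl (by omega)
  simp only [consSeq] at h3 h4
  have h5 := (add_add_le_nbSum H hx (hprev i le_rfl (by omega)) hc (hp.1 i (by omega)) hc₁.symm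
    (hne i le_rfl (by omega)) hc₂).trans (hsp i le_rfl)
  have h6 : 1 / t + pathRatio lam 1 + pathRatio lam n ≤ lam :=
    le_of_mul_le_mul_right (by linarith) (hx (p i))
  have h7 := (pathRatio_mem ht T.lam_eq n).2
  linarith [T.spider_one]

/-- One end of a long path: at most one vertex has a further neighbour, and that is a leaf. -/
theorem Thresholds.end_structure (T : Thresholds t lam n M)
    (h : HasLocalSupersolutions H lam (M + 2)) {L : ℕ} (hL : 2 * M + 2 ≤ L)
    (hchord : ∀ p, IsLongest H p L → ∀ a b, a + 2 ≤ b → b ≤ L → ¬ H.Adj (p a) (p b))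
    {p : ℕ → V} (hp : IsLongest H p L) :
    ∃ i, 1 ≤ i ∧ i < n ∧ pathRatio lam i + 1 / lam + 1 / t ≤ lam ∧
      ∃ c, ∀ k, 1 ≤ k → k < n → ∀ u, H.Adj (p k) u → u = p (k - 1) ∨ u = p (k + 1) ∨
        (k = i ∧ u = c ∧ (∀ j ≤ L, u ≠ p j) ∧ ∀ w, H.Adj u w → w = p i) := by
  have ht := T.one_le
  have ht0 : 0 < t := by linarith
  have hM := T.le
  have hn := T.two_le
  have hlam0 : 0 < lam := by rw [T.lam_eq]; positivity
  by_cases hbr : ∃ i c, 1 ≤ i ∧ i < n ∧ H.Adj (p i) c ∧ c ≠ p (i - 1) ∧ c ≠ p (i + 1)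
  · obtain ⟨i, c, hi1, hin, hc, hc₁, hc₂⟩ := hbr
    have hoff : ∀ k u, 1 ≤ k → k < n → H.Adj (p k) u → u ≠ p (k - 1) → u ≠ p (k + 1) →
        ∀ j ≤ L, u ≠ p j := by
      rintro k u hk1 hkn hu hu₁ hu₂ j hj rfl
      rcases Nat.lt_or_ge j k with h1 | h1
      · have : j ≠ k - 1 := fun he => hu₁ (by rw [he])
        exact hchord p hp j k (by omega) (by omega) hu.symm
      · have h2 : j ≠ k + 1 := fun he => hu₂ (by rw [he])
        have h3 : j ≠ k := fun he => by subst he; exact H.loopless.irrefl _ hu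
        exact hchord p hp k j (by omega) hj hu
    have hne : p (i - 1) ≠ p (i + 1) := fun he => by
      have := hp.1.2 (i - 1) (by omega) (i + 1) (by omega) he; omega
    refine ⟨i, hi1, hin, ?_, c, fun k hk1 hkn u hu => ?_⟩
    · have h1 := h.spider ht T.lam_eq (hp.1.backward (i := i) (n := i) (by omega) le_rfl)
        (isNonbacktracking_one hc) (hp.1.forward (i := i) (n := M) (by omega)) rfl rfl rfl
        hc₁.symm hne hc₂ (by omega) (by omega) (by omega)
      rw [← pathRatio_one]
      exact not_lt.1 fun hlt => absurd h1 (not_le.2 (T.long i hin hlt))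
    · by_contra! hcon
      obtain ⟨hu₁, hu₂, hcon⟩ := hcon
      rcases lt_trichotomy k i with hki | rfl | hki
      · exact T.no_fork h hp.1 hk1 hki hin (by omega) hc hc₁ hc₂ hu hu₁ hu₂
      · have huc : u = c := by
          by_contra huc
          have := h.four_branches ht T.lam_eq (by omega) (hp.1.1 k (by omega))
            (by have := (hp.1.1 (k - 1) (by omega)).symm
                rwa [Nat.sub_add_cancel hk1] at this) hc hu hne.symm hc₂.symm hu₂.symm hc₁.symm
            hu₁.symm (Ne.symm huc) (hp.1.1 (k + 1) (by omega)) (fun he => by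
              have := hp.1.2 (k + 1 + 1) (by omega) k (by omega) he; omega)
          linarith [T.four]
        obtain ⟨w, hw, hwne⟩ := hcon rfl huc (hoff k u hk1 hkn hu hu₁ hu₂)
        rcases Nat.lt_or_ge 1 k with hk2 | hk2
        · have := h.spider ht T.lam_eq (isNonbacktracking_two hu hw hwne)
            (hp.1.backward (i := k) (n := 2) (by omega) (by omega))
            (hp.1.forward (i := k) (n := n) (by omega)) rfl rfl rfl
            hu₁ hu₂ hne (by omega) (by omega) (by omega)
          linarith [T.spider_two]
        -- Replacing `p 0` by `u` gives another longest path, whose first vertex is adjacent to `w`;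
        -- then `w` lies on it and yields a chord. Hence chords must be excluded on all longest
        -- paths.
        · obtain rfl : k = 1 := by omega
          obtain ⟨K, rfl⟩ : ∃ K, L = K + 1 := ⟨L - 1, by omega⟩
          have hq : IsLongest H (consSeq u fun k => p (k + 1)) (K + 1) :=
            ⟨hp.1.tail.cons hu.symm fun j hj => hoff 1 u le_rfl hkn hu hu₁ hu₂ (j + 1) (by omega),
              hp.2⟩
          obtain ⟨j, hj, hwj⟩ := hq.mem_of_adj_zero (u := w) hw
          rcases j with _ | _ | j
          · rw [hwj] at hw
            exact H.loopless.irrefl _ hw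
          · exact hwne hwj
          · exact hchord _ hq 0 (j + 2) (by omega) hj (by rw [← hwj]; exact hw)
      · exact T.no_fork h hp.1 hi1 hki hkn (by omega) hu hu₁ hu₂ hc hc₁ hc₂
  · push Not at hbr
    -- Without a branch vertex, `i = 1` and `c = p 0` are placeholders; position `1` always has
    -- nonnegative slack.
    refine ⟨1, le_rfl, by omega, ?_, p 0, fun k hk1 hkn u hu => ?_⟩
    · rw [pathRatio_one]
      have h1 : lam - (1 / lam + 1 / lam + 1 / t) = (t ^ 2 - 1) * t / (t ^ 2 + 1) := by
        rw [T.lam_eq]; field_simp; ring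
      have h2 : 0 ≤ (t ^ 2 - 1) * t / (t ^ 2 + 1) :=
        div_nonneg (mul_nonneg (by nlinarith) ht0.le) (by positivity)
      linarith
    · by_cases hu₁ : u = p (k - 1)
      · exact .inl hu₁
      · exact .inr (.inl (hbr k u hk1 hkn hu hu₁))

end Structure

/-! ### Explicit supersolutions on paths with two leaves. -/

section Sequences
variable {t lam : ℝ}

/-- The positive solution along a path that starts at a leaf, with value `1` at position `i` and
exponential decay from there on. -/
def endSeq (t lam : ℝ) (i k : ℕ) : ℝ :=
  (∏ j ∈ Ico k i, pathRatio lam (j + 1)) * (1 / t) ^ (k - i)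

theorem endSeq_of_le {i k : ℕ} (h : i ≤ k) : endSeq t lam i k = (1 / t) ^ (k - i) := by
  simp [endSeq, Finset.Ico_eq_empty_of_le h]

theorem endSeq_of_lt {i k : ℕ} (h : k < i) :
    endSeq t lam i k = pathRatio lam (k + 1) * endSeq t lam i (k + 1) := by
  rw [endSeq, endSeq, Finset.prod_eq_prod_Ico_succ_bot h, show k - i = 0 by omega,
    show k + 1 - i = 0 by omega]
  ring

theorem pathRatio_succ_pos (ht : 1 ≤ t) (hlam : lam = t + 1 / t) (k : ℕ) :
    0 < pathRatio lam (k + 1) :=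
  one_div_pos.2 (by linarith [lt_sub_pathRatio ht hlam k])

theorem endSeq_pos (ht : 1 ≤ t) (hlam : lam = t + 1 / t) (i k : ℕ) : 0 < endSeq t lam i k :=
  mul_pos (Finset.prod_pos fun j _ => pathRatio_succ_pos ht hlam j) (by positivity)

/-- Before position `i` the recursion for `pathRatio` gives equality, after it `(1/t)^k` solves the
recurrence, and at `i` the slack pays for the leaf and for `δ`. -/
theorem endSeq_step (ht : 1 ≤ t) (hlam : lam = t + 1 / t) {i : ℕ} {δ : ℝ}
    (h : pathRatio lam i + 1 / lam + 1 / t + δ ≤ lam) (k : ℕ) :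
    (if 1 ≤ k then endSeq t lam i (k - 1) else 0) + endSeq t lam i (k + 1) +
      (if k = i then 1 / lam + δ else 0) ≤ lam * endSeq t lam i k := by
  have ht0 : 0 < t := by linarith
  have hprev : k ≤ i → (if 1 ≤ k then endSeq t lam i (k - 1) else 0) =
      pathRatio lam k * endSeq t lam i k := by
    intro hk
    rcases k with _ | k
    · simp [pathRatio]
    · simpa using endSeq_of_lt (t := t) (lam := lam) (i := i) (k := k) (by omega)
  rcases lt_trichotomy k i with hk | rfl | hk
  · rw [if_neg hk.ne, hprev hk.le]
    have h1 := endSeq_of_lt (t := t) (lam := lam) hk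
    have h2 := lt_sub_pathRatio ht hlam k
    have h3 : (lam - pathRatio lam k) * endSeq t lam i k = endSeq t lam i (k + 1) := by
      rw [h1, pathRatio, ← mul_assoc, mul_one_div_cancel (by linarith), one_mul]
    linarith
  · rw [if_pos rfl, hprev le_rfl, endSeq_of_le le_rfl, endSeq_of_le (Nat.le_succ k)]
    simp only [Nat.sub_self, pow_zero, show k.succ - k = 1 by omega, pow_one]
    linarith
  · obtain ⟨d, rfl⟩ : ∃ d, k = i + d + 1 := ⟨k - i - 1, by omega⟩
    rw [if_neg (show ¬ i + d + 1 = i by omega), if_pos (show 1 ≤ i + d + 1 by omega),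
      endSeq_of_le (show i ≤ i + d + 1 - 1 by omega),
      endSeq_of_le (show i ≤ i + d + 1 + 1 by omega), endSeq_of_le (show i ≤ i + d + 1 by omega), show i + d + 1 - 1 - i = d by omega,
      show i + d + 1 + 1 - i = d + 1 + 1 by omega, show i + d + 1 - i = d + 1 by omega, hlam]
    refine le_of_eq ?_
    simp only [pow_succ]
    field_simp
    ring

theorem exists_uniform_gap (s : ℕ → ℝ) (a : ℝ) (n : ℕ) :
    ∃ δ > 0, ∀ i < n, s i < a → s i + δ ≤ a := by
  induction n with
  | zero => exact ⟨1, one_pos, fun i hi => absurd hi (by omega)⟩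
  | succ n ih =>
    obtain ⟨δ, hδ, h⟩ := ih
    by_cases hn : s n < a
    · refine ⟨min δ (a - s n), lt_min hδ (sub_pos.2 hn), fun i hi his => ?_⟩
      rcases Nat.lt_succ_iff_lt_or_eq.1 hi with hi | rfl
      · linarith [h i hi his, min_le_left δ (a - s n)]
      · linarith [min_le_right δ (a - s i)]
    · refine ⟨δ, hδ, fun i hi his => ?_⟩
      rcases Nat.lt_succ_iff_lt_or_eq.1 hi with hi | rfl
      · exact h i hi his
      · exact absurd his hn

/-- `g` is a supersolution on the path `0, …, L` with leaves attached at the positions `i`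
and `L - j`. -/
def IsPathSupersolution (lam : ℝ) (L i j : ℕ) (g : ℕ → ℝ) : Prop :=
  (∀ k, 0 < g k) ∧ ∀ k ≤ L, (if 1 ≤ k then g (k - 1) else 0) + (if k < L then g (k + 1) else 0) +
    (if k = i ∨ k = L - j then g k / lam else 0) ≤ lam * g k

/-- Add the solutions coming from the two ends. At each branch position the other solution has size
`(1/t) ^ (L - (i + j))`, and its share in the leaf is covered by `δ`. -/
theorem exists_isPathSupersolution_of_gap (ht : 1 ≤ t) (hlam : lam = t + 1 / t) {δ : ℝ} {i j L : ℕ}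
    (hi : pathRatio lam i + 1 / lam + 1 / t + δ ≤ lam)
    (hj : pathRatio lam j + 1 / lam + 1 / t + δ ≤ lam)
    (hL : i + j < L) (hsmall : (1 / t) ^ (L - (i + j)) ≤ δ * lam) :
    ∃ g, IsPathSupersolution lam L i j g := by
  have ht0 : 0 < t := by linarith
  have hlam0 : 0 < lam := by rw [hlam]; positivity
  have hpos := endSeq_pos ht hlam
  have hδ : 0 ≤ δ := nonneg_of_mul_nonneg_left (le_trans (by positivity) hsmall) hlam0
  have hsmall' : (1 / t) ^ (L - (i + j)) / lam ≤ δ := by rwa [div_le_iff₀ hlam0]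
  refine ⟨fun k => endSeq t lam i k + endSeq t lam j (L - k),
    fun k => add_pos (hpos i k) (hpos j _), fun k hk => ?_⟩
  have h1 := endSeq_step ht hlam hi k
  have h2 := endSeq_step ht hlam hj (L - k)
  have h3 : (if 1 ≤ k then endSeq t lam i (k - 1) + endSeq t lam j (L - (k - 1)) else 0) ≤
      (if 1 ≤ k then endSeq t lam i (k - 1) else 0) + endSeq t lam j (L - k + 1) := by
    split_ifs with hk1
    · rw [show L - (k - 1) = L - k + 1 by omega]
    · have := hpos j (L - k + 1); linarith
  have h4 : (if k < L then endSeq t lam i (k + 1) + endSeq t lam j (L - (k + 1)) else 0) ≤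
      endSeq t lam i (k + 1) + if 1 ≤ L - k then endSeq t lam j (L - k - 1) else 0 := by
    by_cases hk1 : k < L
    · rw [if_pos hk1, if_pos (by omega), Nat.sub_sub]
    · rw [if_neg hk1, if_neg (by omega), add_zero]; exact (hpos i (k + 1)).le
  have h5 : (if k = i ∨ k = L - j then (endSeq t lam i k + endSeq t lam j (L - k)) / lam else 0) ≤
      (if k = i then 1 / lam + δ else 0) + if L - k = j then 1 / lam + δ else 0 := by
    by_cases hki : k = i
    · have hkj : ¬ L - k = j := by omega
      rw [if_pos (.inl hki), if_pos hki, if_neg hkj, hki, endSeq_of_le le_rfl,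
        endSeq_of_le (by omega), show L - i - j = L - (i + j) by omega]
      simp only [Nat.sub_self, pow_zero, add_div]
      linarith
    · by_cases hkj : k = L - j
      · rw [if_pos (.inr hkj), if_neg hki, if_pos (by omega), hkj, show L - (L - j) = j by omega,
          endSeq_of_le (by omega), endSeq_of_le le_rfl, show L - j - i = L - (i + j) by omega]
        simp only [Nat.sub_self, pow_zero, add_div]
        linarith
      · rw [if_neg (by tauto), if_neg hki, if_neg (by omega), add_zero]
  simp only
  linarith

/-- This is the null vector of an affine Dynkin diagram of type `D`: `1` at the ends and the two
leaves, `2` elsewhere. -/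
theorem exists_isPathSupersolution_two {L : ℕ} (hL : 3 ≤ L) :
    ∃ g, IsPathSupersolution 2 L 1 1 g := by
  refine ⟨fun k => if k = 0 ∨ k = L then 1 else 2, fun k => by simp only; split_ifs <;> norm_num,
    fun k hk => ?_⟩
  have h2 : ∀ j, (if j = 0 ∨ j = L then (1 : ℝ) else 2) ≤ 2 := fun j => by split_ifs <;> norm_num
  simp only
  by_cases h0 : k = 0
  · subst h0
    have := h2 1
    simp only [show ¬ 1 ≤ 0 by omega, show 0 < L by omega, show ¬ (0 = 1 ∨ 0 = L - 1) by omega,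
      if_true, if_false, zero_add, true_or] at this ⊢
    linarith
  by_cases h1 : k = 1
  · subst h1
    simp only [le_refl, show 1 < L by omega, show ¬ (1 = 0 ∨ 1 = L) by omega,
      show ¬ (1 + 1 = 0 ∨ 1 + 1 = L) by omega, true_or, if_true, if_false]
    norm_num
  by_cases hl : k = L
  · subst hl
    have := h2 (k - 1)
    simp only [show 1 ≤ k by omega, lt_irrefl, show ¬ (k = 1 ∨ k = k - 1) by omega,
      or_true, if_true, if_false] at this ⊢
    linarith
  by_cases hl1 : k = L - 1
  · have e1 : k + 1 = L := by omega
    simp only [show 1 ≤ k by omega, show k < L by omega, show ¬ (k = 0 ∨ k = L) by omega,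
      show ¬ (k - 1 = 0 ∨ k - 1 = L) by omega, show k + 1 = 0 ∨ k + 1 = L by omega,
      show k = 1 ∨ k = L - 1 by omega, if_true, if_false]
    norm_num
  · have e1 := h2 (k - 1)
    have e2 := h2 (k + 1)
    simp only [show 1 ≤ k by omega, show k < L by omega, show ¬ (k = 0 ∨ k = L) by omega,
      show ¬ (k = 1 ∨ k = L - 1) by omega, if_true, if_false]
    linarith

/-- For `t > 1` zero slack at `i ≥ 2` means `lam = alpha i`, and position `1` has positive slack, so
a uniform gap exists. For `t = 1` only position `1` is admissible, with slack zero, and the explicit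
vector is needed. -/
theorem exists_isPathSupersolution (ht : 1 ≤ t) (hlam : lam = t + 1 / t)
    (hα : ¬ ∃ m : ℕ, 2 ≤ m ∧ lam = alpha m) (n : ℕ) :
    ∃ K, ∀ L ≥ K, ∀ i j, 1 ≤ i → i < n → 1 ≤ j → j < n →
      pathRatio lam i + 1 / lam + 1 / t ≤ lam → pathRatio lam j + 1 / lam + 1 / t ≤ lam →
      ∃ g, IsPathSupersolution lam L i j g := by
  have ht0 : 0 < t := by linarith
  have hlam0 : 0 < lam := by rw [hlam]; positivity
  rcases ht.eq_or_lt with rfl | ht1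
  · have hlam2 : lam = 2 := by rw [hlam]; norm_num
    have hone : ∀ i, 1 ≤ i → pathRatio lam i + 1 / lam + 1 / 1 ≤ lam → i = 1 := by
      intro i hi hs
      by_contra hne
      have h1 := pathRatio_mono le_rfl hlam (show 2 ≤ i by omega)
      have h2 : pathRatio lam 2 = 2 / 3 := by
        simp only [pathRatio, hlam2]; norm_num
      rw [h2] at h1
      rw [hlam2] at h1 hs
      norm_num at hs
      linarith
    refine ⟨3, fun L hL i j hi _ hj _ hsi hsj => ?_⟩
    rw [hone i hi hsi, hone j hj hsj, hlam2]
    exact exists_isPathSupersolution_two hL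
  · obtain ⟨δ, hδ, hgap⟩ :=
      exists_uniform_gap (fun i => pathRatio lam i + 1 / lam + 1 / t) lam n
    obtain ⟨K, hK⟩ := exists_pow_lt_of_lt_one (mul_pos hδ hlam0)
      (show 1 / t < 1 by rw [div_lt_one ht0]; exact ht1)
    have hstrict : ∀ i, 1 ≤ i → i < n → pathRatio lam i + 1 / lam + 1 / t ≤ lam →
        pathRatio lam i + 1 / lam + 1 / t + δ ≤ lam := by
      intro i hi hin hs
      refine hgap i hin (hs.lt_of_ne fun heq => ?_)
      rcases Nat.lt_or_ge 1 i with h1 | h1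
      · exact hα ⟨i, h1, eq_alpha_of_slack_eq_zero ht1 hlam hi heq⟩
      · obtain rfl : i = 1 := by omega
        rw [pathRatio_one] at heq
        have h1 : lam - (1 / lam + 1 / lam + 1 / t) = (t ^ 2 - 1) * t / (t ^ 2 + 1) := by
          rw [hlam]; field_simp; ring
        have h2 : 0 < (t ^ 2 - 1) * t / (t ^ 2 + 1) :=
          div_pos (mul_pos (by nlinarith) ht0) (by positivity)
        linarith
    refine ⟨K + 2 * n, fun L hL i j hi hin hj hjn hsi hsj => ?_⟩
    refine exists_isPathSupersolution_of_gap ht hlam (hstrict i hi hin hsi)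
      (hstrict j hj hjn hsj) (by omega) (le_trans ?_ hK.le)
    exact pow_le_pow_of_le_one (by positivity) (by rw [div_le_one ht0]; exact ht) (by omega)

end Sequences

/-! ### Assembling the global supersolution. -/

section Final
variable {V : Type*} [Fintype V] {H : SimpleGraph V} {t lam : ℝ}

/-- A path with at most one leaf attached at each of two positions inherits supersolutions. -/
theorem IsPathSupersolution.exists_supersolution (hH : H.Connected) (hlam : 0 < lam) {p : ℕ → V}
    {L i j : ℕ} (hp : IsPathSeq H p L) {g : ℕ → ℝ} (hg : IsPathSupersolution lam L i j g)
    (hij : i + j < L) {c d : V}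
    (hnb : ∀ k ≤ L, ∀ u, H.Adj (p k) u → (1 ≤ k ∧ u = p (k - 1)) ∨ (k < L ∧ u = p (k + 1)) ∨
      (k = i ∧ u = c ∧ (∀ l ≤ L, u ≠ p l) ∧ ∀ w, H.Adj u w → w = p i) ∨
      (k = L - j ∧ u = d ∧ (∀ l ≤ L, u ≠ p l) ∧ ∀ w, H.Adj u w → w = p (L - j))) :
    ∃ x : V → ℝ, (∀ v, 0 < x v) ∧ ∀ v, nbSum H x v ≤ lam * x v := by
  classical
  obtain ⟨hg0, hg1⟩ := hg
  have hpij : p i ≠ p (L - j) := fun he => by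
    have := hp.2 i (by omega) (L - j) (by omega) he; omega
  -- A leaf gets the value at its support divided by `lam`, which makes its own equation exact; the
  -- test on neighbours decides which end it hangs from.
  set f : V → ℝ := fun v => if h : ∃ k ≤ L, v = p k then g h.choose else
    if ∀ w, H.Adj v w → w = p i then g i / lam else g (L - j) / lam with hf
  have hfp : ∀ k ≤ L, f (p k) = g k := by
    intro k hk
    have h : ∃ l ≤ L, p k = p l := ⟨k, hk, rfl⟩
    simp only [hf, dif_pos h]
    rw [hp.2 _ h.choose_spec.1 k hk h.choose_spec.2.symm]
  have hfi : ∀ v, (∀ l ≤ L, v ≠ p l) → (∀ w, H.Adj v w → w = p i) → f v = g i / lam := by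
    intro v hv hw
    have h : ¬ ∃ l ≤ L, v = p l := by push Not; exact hv
    simp only [hf, dif_neg h, if_pos hw]
  have hfj : ∀ v, (∀ l ≤ L, v ≠ p l) → H.Adj v (p (L - j)) → f v = g (L - j) / lam := by
    intro v hv hw
    have h : ¬ ∃ l ≤ L, v = p l := by push Not; exact hv
    simp only [hf, dif_neg h, if_neg (show ¬ ∀ w, H.Adj v w → w = p i from
      fun hall => hpij (hall _ hw).symm)]
  have hf0 : ∀ v, 0 < f v := by
    intro v
    simp only [hf]
    split_ifs
    · exact hg0 _
    · exact div_pos (hg0 _) hlam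
    · exact div_pos (hg0 _) hlam
  have hall := mem_of_connected_of_closed hH (v := p 0)
    (P := fun v => (∃ k ≤ L, v = p k) ∨
      ((∀ l ≤ L, v ≠ p l) ∧ (∀ w, H.Adj v w → w = p i)) ∨
      ((∀ l ≤ L, v ≠ p l) ∧ H.Adj v (p (L - j)) ∧ ∀ w, H.Adj v w → w = p (L - j)))
    (.inl ⟨0, Nat.zero_le _, rfl⟩) (by
      rintro a b hab (⟨k, hk, rfl⟩ | ⟨-, h⟩ | ⟨-, -, h⟩)
      · rcases hnb k hk b hab with ⟨-, h⟩ | ⟨h1, h⟩ | ⟨-, -, h, h'⟩ | ⟨rfl, -, h, h'⟩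
        · exact .inl ⟨k - 1, by omega, h⟩
        · exact .inl ⟨k + 1, by omega, h⟩
        · exact .inr (.inl ⟨h, h'⟩)
        · exact .inr (.inr ⟨h, hab.symm, h'⟩)
      · exact .inl ⟨i, by omega, h b hab⟩
      · exact .inl ⟨L - j, by omega, h b hab⟩)
  refine ⟨f, hf0, fun v => ?_⟩
  rcases hall v with ⟨k, hk, rfl⟩ | ⟨hoff, hv⟩ | ⟨hoff, hadj, hv⟩
  · rw [hfp k hk]
    refine le_trans ?_ (hg1 k hk)
    set s₁ : Finset V := if 1 ≤ k then {p (k - 1)} else ∅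
    set s₂ : Finset V := if k < L then {p (k + 1)} else ∅
    set s₃ : Finset V := {u | H.Adj (p k) u ∧ (∀ l ≤ L, u ≠ p l)}
    have h1 : nbSum H f (p k) ≤ ∑ u ∈ s₁ ∪ s₂ ∪ s₃, f u := by
      refine nbSum_le_of_subset (fun v => (hf0 v).le) fun u hu => ?_
      rcases hnb k hk u hu with ⟨h0, h⟩ | ⟨h0, h⟩ | ⟨-, -, h, -⟩ | ⟨-, -, h, -⟩
      · simp [s₁, h0, h]
      · simp [s₂, h0, h]
      · simp only [mem_union, s₃, mem_filter, mem_univ, true_and]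
        exact .inr ⟨hu, h⟩
      · simp only [mem_union, s₃, mem_filter, mem_univ, true_and]
        exact .inr ⟨hu, h⟩
    have hun : ∀ a b : Finset V, ∑ u ∈ a ∪ b, f u ≤ ∑ u ∈ a, f u + ∑ u ∈ b, f u := fun a b => by
      rw [← Finset.sum_union_inter]
      have := Finset.sum_nonneg (s := a ∩ b) fun u _ => (hf0 u).le
      linarith
    have h2 : ∑ u ∈ s₁, f u = if 1 ≤ k then g (k - 1) else 0 := by
      simp only [s₁]
      split_ifs
      · rw [Finset.sum_singleton, hfp _ (by omega)]
      · simp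
    have h3 : ∑ u ∈ s₂, f u = if k < L then g (k + 1) else 0 := by
      simp only [s₂]
      split_ifs
      · rw [Finset.sum_singleton, hfp _ (by omega)]
      · simp
    have h4 : ∑ u ∈ s₃, f u ≤ if k = i ∨ k = L - j then g k / lam else 0 := by
      have hmem : ∀ u ∈ s₃, (k = i ∧ u = c ∧ f u = g k / lam) ∨
          (k = L - j ∧ u = d ∧ f u = g k / lam) := by
        intro u hu
        simp only [s₃, mem_filter, mem_univ, true_and] at hu
        rcases hnb k hk u hu.1 with ⟨-, h⟩ | ⟨h0, h⟩ | ⟨rfl, hc, h, h'⟩ | ⟨rfl, hd, h, -⟩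
        · exact absurd h (hu.2 _ (by omega))
        · exact absurd h (hu.2 _ (by omega))
        · exact .inl ⟨rfl, hc, hfi u h h'⟩
        · exact .inr ⟨rfl, hd, hfj u h hu.1.symm⟩
      by_cases hki : k = i
      · rw [if_pos (.inl hki)]
        have hsub : s₃ ⊆ {c} := fun u hu => by
          rcases hmem u hu with ⟨-, h, -⟩ | ⟨h, -⟩
          · simp [h]
          · omega
        rcases Finset.subset_singleton_iff.1 hsub with he | he
        · rw [he, Finset.sum_empty]; exact (div_pos (hg0 k) hlam).le
        · rw [he, Finset.sum_singleton]
          rcases hmem c (by rw [he]; simp) with ⟨-, -, h⟩ | ⟨-, -, h⟩ <;> exact h.le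
      · by_cases hkj : k = L - j
        · rw [if_pos (.inr hkj)]
          have hsub : s₃ ⊆ {d} := fun u hu => by
            rcases hmem u hu with ⟨h, -⟩ | ⟨-, h, -⟩
            · omega
            · simp [h]
          rcases Finset.subset_singleton_iff.1 hsub with he | he
          · rw [he, Finset.sum_empty]; exact (div_pos (hg0 k) hlam).le
          · rw [he, Finset.sum_singleton]
            rcases hmem d (by rw [he]; simp) with ⟨-, -, h⟩ | ⟨-, -, h⟩ <;> exact h.le
        · rw [if_neg (by tauto), Finset.sum_eq_zero]
          intro u hu
          rcases hmem u hu with ⟨h, -⟩ | ⟨h, -⟩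
          · exact absurd h hki
          · exact absurd h hkj
    linarith [hun (s₁ ∪ s₂) s₃, hun s₁ s₂]
  · rw [hfi v hoff hv, mul_div_cancel₀ _ hlam.ne', ← hfp i (by omega)]
    have := nbSum_le_of_subset (H := H) (s := {p i}) (v := v) (fun v => (hf0 v).le)
      fun u hu => by simpa using hv u hu
    simpa using this
  · rw [hfj v hoff hadj, mul_div_cancel₀ _ hlam.ne', ← hfp (L - j) (by omega)]
    have := nbSum_le_of_subset (H := H) (s := {p (L - j)}) (v := v) (fun v => (hf0 v).le)
      fun u hu => by simpa using hv u hu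
    simpa using this

theorem exists_bound_of_two_le {lam : ℝ} (h2 : 2 ≤ lam) (hlt : lam < lambdaStar)
    (hα : ¬ ∃ m : ℕ, 2 ≤ m ∧ lam = alpha m) : ∃ B : ℕ, ∀ {V : Type} [Fintype V]
    (H : SimpleGraph V), H.Connected → IsLocallyBounded H lam B →
      ∃ x : V → ℝ, (∀ v, 0 < x v) ∧ ∀ v, nbSum H x v ≤ lam * x v := by
  obtain ⟨t, ht, hlam⟩ := exists_add_inv_eq h2
  obtain ⟨n, M, T⟩ := exists_thresholds ht hlam hlt
  obtain ⟨K, hK⟩ := exists_isPathSupersolution ht hlam hα n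
  have hM := T.le
  have hn := T.two_le
  -- A longest path shorter than `D` leaves at most `5 ^ D` vertices, so the local bound is already
  -- global; otherwise `L` is large enough for the structure at both ends and for `hK`.
  set D := K + 2 * M + 4 with hD
  refine ⟨5 ^ D, fun {V} _ H hH h => ?_⟩
  have hB : 6 ≤ 5 ^ D := by
    calc 6 ≤ 5 ^ 2 := by norm_num
      _ ≤ 5 ^ D := Nat.pow_le_pow_right (by norm_num) (by omega)
  have := hH.nonempty
  obtain ⟨p, L, hp⟩ := exists_isLongest H
  have hloc := h.hasLocalSupersolutions hB hlt (R := M + 2)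
    (Nat.pow_le_pow_right (by norm_num) (by omega))
  rcases Nat.lt_or_ge L D with hL | hL
  · refine h.exists_supersolution_of_card_le hH ((hp.card_le hH (h.degree_le hB hlt)).trans ?_)
    exact Nat.pow_le_pow_right (by norm_num) hL.le
  by_cases hchord : ∀ p, IsLongest H p L → ∀ a b, a + 2 ≤ b → b ≤ L → ¬ H.Adj (p a) (p b)
  · obtain ⟨i, hi1, hin, hsi, c, hc⟩ := T.end_structure hloc (by omega) hchord hp
    obtain ⟨j, hj1, hjn, hsj, d, hd⟩ := T.end_structure hloc (by omega) hchord hp.reverse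
    obtain ⟨g, hg⟩ := hK L (by omega) i j hi1 hin hj1 hjn hsi hsj
    have hends : ∀ p, IsLongest H p L → ∀ u, H.Adj (p 0) u → u = p 1 := by
      intro p hp u hu
      obtain ⟨l, hl, rfl⟩ := hp.mem_of_adj_zero hu
      rcases l with _ | _ | l
      · exact absurd hu (H.loopless.irrefl _)
      · rfl
      · exact absurd hu (hchord p hp 0 (l + 2) (by omega) hl)
    refine hg.exists_supersolution hH (by linarith) hp.1 (by omega) (c := c) (d := d)
      fun k hk u hu => ?_
    rcases Nat.eq_zero_or_pos k with rfl | hk0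
    · exact .inr (.inl ⟨by omega, hends p hp u hu⟩)
    rcases hk.eq_or_lt with rfl | hkL
    · have := hends _ hp.reverse u (by simpa using hu)
      exact .inl ⟨hk0, this⟩
    rcases Nat.lt_or_ge k n with hkn | hkn
    · rcases hc k hk0 hkn u hu with h1 | h1 | h1
      · exact .inl ⟨hk0, h1⟩
      · exact .inr (.inl ⟨hkL, h1⟩)
      · exact .inr (.inr (.inl h1))
    rcases Nat.lt_or_ge L (k + n) with hkn' | hkn'
    · have hkk : L - (L - k) = k := by omega
      rcases hd (L - k) (by omega) (by omega) u (by simpa only [hkk] using hu) with h1 | h1 | h1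
      · rw [show L - (L - k - 1) = k + 1 by omega] at h1
        exact .inr (.inl ⟨hkL, h1⟩)
      · rw [show L - (L - k + 1) = k - 1 by omega] at h1
        exact .inl ⟨hk0, h1⟩
      · refine .inr (.inr (.inr ⟨by omega, h1.2.1, fun l hl => ?_, h1.2.2.2⟩))
        have := h1.2.2.1 (L - l) (by omega)
        rwa [show L - (L - l) = l by omega] at this
    · rcases T.middle hloc hp.1 hkn hkn' hu with h1 | h1
      · exact .inl ⟨hk0, h1⟩
      · exact .inr (.inl ⟨hkL, h1⟩)
  · push Not at hchord
    obtain ⟨q, hq, a, b, hab, hb, hadj⟩ := hchord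
    exact T.supersolution_of_chord hloc hH hq.1 hab hb hadj

end Final

end ForbiddenSubgraphs

end

open ForbiddenSubgraphs in
theorem mainTheorem1 :
    (∀ lam : ℝ, lam < lambdaStar → (¬ ∃ m : ℕ, 2 ≤ m ∧ lam = alpha m) →
      ∃ 𝒢 : Set FinGraph, 𝒢.Finite ∧ (∀ G ∈ 𝒢, G.graph.Connected) ∧
        family lam = connectedAvoiding 𝒢) ∧
    (∀ lam : ℝ, ((∃ m : ℕ, 2 ≤ m ∧ lam = alpha m) ∨ lambdaStar ≤ lam) →
      (¬ ∃ 𝒢 : Set FinGraph, 𝒢.Finite ∧ (∀ G ∈ 𝒢, lam < spectralRadius G.graph) ∧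
        family lam = connectedAvoiding 𝒢) ∧
      lam ∈ rightLimitPoints spectralRadii) := by
  refine ⟨fun lam hlt hα => exists_finite_forbidden ?_,
    fun lam h => infinite_forbidden_and_limit h⟩
  rcases lt_or_ge lam 2 with h2 | h2
  · exact exists_bound_of_lt_two h2
  · exact exists_bound_of_two_le h2 hlt hα
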